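/- Let $q>2$ be a power of $2$, and let $V$ be an $\mathrm{O}^+(8,q)$-space, that is, an $8$-dimensional vector space over $\mathbb{F}_q$ with a quadratic form $Q$ whose associated bilinear form $(x,y)\mapsto Q(x+y)-Q(x)-Q(y)$ is nondegenerate and for which there is a totally singular subspace of dimension $4$ (a subspace is totally singular if $Q$ vanishes on it). The associated bilinear form is alternating, so it makes $V$ a symplectic space. An orthogonal (respectively symplectic) partial spread of $V$ is a set of $4$-dimensional totally singular (respectively totally isotropic) subspaces, any two distinct members of which intersect only in $0$; it is maximal if it is not properly contained in another partial spread of the same kind. For every integer $s$ with $1\le s\le q/5$, $V$ has a maximal orthogonal partial spread of size $$n_s=q^3-sq^2+(s-1)(q+2)+\binom{s}{2}(q-2)+1,$$ which is also a maximal symplectic partial spread of $V$. Moreover, if $q\ge 16$, then $V$ has a maximal orthogonal partial spread of size $n_4-1$, where $n_4=q^3-4q^2+3(q+2)+6(q-2)+1$, and it is also a maximal symplectic partial spread of $V$. -/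

import Mathlib

namespace OrthogonalSpreads

variable {K V : Type*} [Field K] [AddCommGroup V] [Module K V]

/-- `(V, Q)` is an `O⁺(2n, q)`-space (`q = |K|`): a `2n`-dimensional vector space with a quadratic
form whose polar form is nondegenerate, and which has a totally singular subspace of (the largest
possible) dimension `n`. -/
def IsOPlusSpace (n : ℕ) (Q : QuadraticForm K V) : Prop :=
  FiniteDimensional K V ∧ Module.finrank K V = 2 * n ∧
    LinearMap.BilinForm.Nondegenerate Q.polarBilin ∧
    ∃ W : Submodule K V, Module.finrank K W = n ∧ ∀ x ∈ W, Q x = 0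

/-- A partial spread of a `2n`-dimensional space: a set of `n`-dimensional subspaces, any two of
which meet only in `0`. -/
def IsPartialSpread (S : Set (Submodule K V)) : Prop :=
  (∀ X ∈ S, 2 * Module.finrank K X = Module.finrank K V) ∧
    ∀ X ∈ S, ∀ Y ∈ S, X ≠ Y → X ⊓ Y = ⊥

/-- A partial spread all of whose members are totally singular. -/
def IsOrthogonalPartialSpread (Q : QuadraticForm K V) (S : Set (Submodule K V)) : Prop :=
  IsPartialSpread S ∧ ∀ X ∈ S, ∀ x ∈ X, Q x = 0

/-- A partial spread all of whose members are totally isotropic for the form `B`. -/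
def IsSymplecticPartialSpread (B : LinearMap.BilinForm K V) (S : Set (Submodule K V)) : Prop :=
  IsPartialSpread S ∧ ∀ X ∈ S, ∀ x ∈ X, ∀ y ∈ X, B x y = 0

/-- Maximal, with respect to inclusion, among the orthogonal partial spreads. -/
def IsMaximalOrthogonalPartialSpread (Q : QuadraticForm K V) (S : Set (Submodule K V)) : Prop :=
  Maximal (IsOrthogonalPartialSpread Q) S

/-- Maximal, with respect to inclusion, among the symplectic partial spreads. -/
def IsMaximalSymplecticPartialSpread (B : LinearMap.BilinForm K V)
    (S : Set (Submodule K V)) : Prop :=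
  Maximal (IsSymplecticPartialSpread B) S

/-- The integer `n_s = q³ - s q² + (s - 1)(q + 2) + (s choose 2)(q - 2) + 1`. -/
def spreadSize (q s : ℕ) : ℤ :=
  (q : ℤ) ^ 3 - s * (q : ℤ) ^ 2 + ((s : ℤ) - 1) * (q + 2) + (s.choose 2 : ℤ) * ((q : ℤ) - 2) + 1

end OrthogonalSpreads

/-! ### Trace, norm and adjoint identities in a cyclic cubic extension -/

namespace OrthogonalSpreads

/-! Fix a totally singular 4-space `W` and write `V = K⁴ × K⁴` with `Q (x, y) = x ⬝ᵥ y` and `W = 0 ×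
K⁴`. The totally singular 4-spaces meeting `W` trivially are the graphs of alternating matrices, and
two graphs meet trivially exactly when the Pfaffian of the difference is nonzero. The Pfaffian is a
hyperbolic form on a 6-space, so a spread through `W` becomes a set of points of that 6-space with
no singular differences. In characteristic two a symmetric matrix is alternating plus `e eᵀ`, and
adding `e eᵀ` does not change the determinant; hence orthogonal maximality already forces symplectic
maximality (`exists_maximal_spread`).

Such a point set is the affine part of a partial ovoid of the quadric `a d = T(βγ)` on `K ⊕ F ⊕ F ⊕
K`, with `F / K` cubic. This quadric has an ovoid with one point at infinity and `q³` affine points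
indexed by `t ∈ F`; the vector `(a, β, γ, d)` is perpendicular to the point `t` exactly when the
cubic `f` vanishes at `t`. Take `s` pairwise non-perpendicular singular points off the ovoid, all
perpendicular to its point at infinity, and exchange them for the ovoid points perpendicular to at
least one of them.

Maximality is a count (`exists_maximal_family`). A singular point off the ovoid is perpendicular to
at least `q²` affine ovoid points (`le_card_f_zero`). If it could be added, all of these would have
been removed, yet each new point accounts for at most `3q` of them (`card_Z_inter_f_le`); this is
impossible when `3s < q`.

The size depends on how the removed sets overlap: each has `q²` affine points, two share `2q - 1`,
three share `q + 1`. With new points on a conic, lying in three sets means lying in all of them, and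
inclusion-exclusion gives `n_s` (`card_removed`). Moving one of four points off the conic drops the
fourfold intersection from `q + 1` to `q`, so one more point is removed (`card_removed_four`). -/

/-- A cubic extension `F / K` of fields of characteristic two together with a generator `σ` of its
Galois group, its trace `T` and its norm `N`. -/
structure CyclicCubic (K F : Type*) [Field K] [Field F] [Algebra K F] where
  σ : F →+* F
  T : F → K
  N : F → K
  σ_three : ∀ x, σ (σ (σ x)) = x
  σ_algebraMap : ∀ k, σ (algebraMap K F k) = algebraMap K F k
  fixed : ∀ x, σ x = x → ∃ k, algebraMap K F k = x
  exists_moved : ∃ x, σ x ≠ x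
  algebraMap_T : ∀ x, algebraMap K F (T x) = x + σ x + σ (σ x)
  algebraMap_N : ∀ x, algebraMap K F (N x) = x * σ x * σ (σ x)

namespace CyclicCubic

variable {K F : Type*} [Field K] [Field F] [Algebra K F] (C : CyclicCubic K F)

/-- The adjoint `σ(t) σ²(t)`, which is `N(t) / t` for `t ≠ 0`. -/
def adj (t : F) : F := C.σ t * C.σ (C.σ t)

/-- The polarization of the adjoint. -/
def cross (x y : F) : F := C.σ x * C.σ (C.σ y) + C.σ (C.σ x) * C.σ y

/-- The cubic form attached to the vector `(a, β, γ, d)`. -/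
def f (a : K) (β γ : F) (d : K) (t : F) : K :=
  a * C.N t + C.T (β * C.adj t) + C.T (γ * t) + d

theorem ext_iff {x y : K} : x = y ↔ algebraMap K F x = algebraMap K F y :=
  (algebraMap K F).injective.eq_iff.symm

theorem two_eq_zero [CharP F 2] : (2 : F) = 0 := CharTwo.two_eq_zero

theorem T_zero : C.T 0 = 0 := by
  rw [ext_iff (F := F)]; simp [C.algebraMap_T]

theorem N_zero : C.N 0 = 0 := by
  rw [ext_iff (F := F)]; simp [C.algebraMap_N]

theorem adj_zero : C.adj 0 = 0 := by simp [adj]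

theorem T_add (x y : F) : C.T (x + y) = C.T x + C.T y := by
  rw [ext_iff (F := F)]; simp only [C.algebraMap_T, map_add]; ring

theorem T_smul (k : K) (x : F) : C.T (algebraMap K F k * x) = k * C.T x := by
  rw [ext_iff (F := F)]; simp only [C.algebraMap_T, map_mul, C.σ_algebraMap]; ring

/-- Translations of `F` act on the cubics `f`; this allows a pole or a zero to be moved to the
origin. -/
theorem f_add [CharP F 2] (a : K) (β γ : F) (d : K) (t b : F) :
    C.f a β γ d (t + b) = C.f a (β + algebraMap K F a * b)
      (γ + C.cross β b + algebraMap K F a * C.adj b) (C.f a β γ d b) t := by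
  rw [ext_iff (F := F)]
  simp only [f, adj, cross, C.algebraMap_T, C.algebraMap_N, map_add, map_mul, C.σ_algebraMap,
    C.σ_three]
  ring

theorem cross_cross [CharP F 2] (β e γ : F) : C.cross β (C.cross e γ) =
    e * algebraMap K F (C.T (β * γ)) + γ * algebraMap K F (C.T (β * e)) := by
  have h2 := two_eq_zero (F := F)
  simp only [cross, C.algebraMap_T, map_add, map_mul, C.σ_three]
  grind

theorem T_algebraMap [CharP F 2] (k : K) : C.T (algebraMap K F k) = k := by
  rw [ext_iff (F := F), C.algebraMap_T, C.σ_algebraMap, C.σ_algebraMap]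
  linear_combination algebraMap K F k * two_eq_zero (F := F)

theorem σ_eq_zero {x : F} : C.σ x = 0 ↔ x = 0 := map_eq_zero _

theorem N_eq_zero {x : F} : C.N x = 0 ↔ x = 0 := by
  rw [ext_iff (F := F), C.algebraMap_N, map_zero]
  simp

theorem adj_eq_zero {x : F} : C.adj x = 0 ↔ x = 0 := by simp [adj]

theorem adj_inv (x : F) : C.adj x⁻¹ = (C.adj x)⁻¹ := by simp [adj, mul_comm]

theorem adj_mul (x y : F) : C.adj (x * y) = C.adj x * C.adj y := by
  simp only [adj, map_mul]; ring

theorem adj_algebraMap (k : K) : C.adj (algebraMap K F k) = algebraMap K F k ^ 2 := by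
  simp only [adj, C.σ_algebraMap]; ring

theorem mul_adj (x : F) : x * C.adj x = algebraMap K F (C.N x) := by
  rw [C.algebraMap_N, adj, mul_assoc]

theorem adj_adj (x : F) : C.adj (C.adj x) = algebraMap K F (C.N x) * x := by
  simp only [C.algebraMap_N, adj, map_mul, C.σ_three]; ring

theorem N_inv (x : F) : C.N x⁻¹ = (C.N x)⁻¹ := by
  rw [ext_iff (F := F)]; simp [C.algebraMap_N, mul_comm, mul_assoc, mul_left_comm]

theorem adj_eq (x : F) : C.adj x = algebraMap K F (C.N x) * x⁻¹ := by
  by_cases hx : x = 0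
  · simp [hx, adj_zero]
  · rw [← mul_adj]; field_simp

/-- Since `adj t = N(t) t⁻¹`, inversion turns the quadratic condition `T(c adj t) = 0` into a linear
one. -/
theorem T_mul_adj (c t : F) : C.T (c * C.adj t) = C.N t * C.T (c * t⁻¹) := by
  rw [adj_eq, ← T_smul]; ring_nf

theorem T_mul_adj_eq_zero {c t : F} : C.T (c * C.adj t) = 0 ↔ C.T (c * t⁻¹) = 0 := by
  rw [T_mul_adj]
  by_cases ht : t = 0
  · simp [ht, T_zero]
  · simp [C.N_eq_zero, ht]

theorem T_adj_self [CharP F 2] (x : F) : C.T (x * C.adj x) = C.N x := by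
  rw [mul_adj, T_algebraMap]

theorem σσ_of_T [CharP F 2] {c : F} (hc : C.T c = 0) : C.σ (C.σ c) = c + C.σ c := by
  have h := C.algebraMap_T c
  rw [hc, map_zero] at h
  linear_combination h + (C.σ (C.σ c)) * two_eq_zero (F := F)

theorem T_sq [CharP F 2] {c : F} (hc : C.T c = 0) : C.T (c * c) = 0 := by
  have h2 := two_eq_zero (F := F)
  rw [ext_iff (F := F)]
  simp only [C.algebraMap_T, map_mul, C.σσ_of_T hc, map_zero]
  grind

theorem T_mul_cross_self [CharP F 2] (c x : F) : C.T (c * C.cross c x) = 0 := by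
  have h2 := two_eq_zero (F := F)
  rw [ext_iff (F := F)]
  simp only [cross, C.algebraMap_T, map_add, map_mul, C.σ_three, map_zero]
  grind

theorem T_mul_cross (c d x : F) : C.T (c * C.cross d x) = C.T (d * C.cross c x) := by
  rw [ext_iff (F := F)]
  simp only [cross, C.algebraMap_T, map_add, map_mul, C.σ_three]
  ring

theorem adj_add (x y : F) : C.adj (x + y) = C.adj x + C.cross x y + C.adj y := by
  simp only [adj, cross, map_add]; ring

theorem cross_add (x y z : F) : C.cross x (y + z) = C.cross x y + C.cross x z := by
  simp only [cross, map_add]; ring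

theorem cross_algebraMap [CharP F 2] {c : F} (hc : C.T c = 0) (k : K) :
    C.cross c (algebraMap K F k) = algebraMap K F k * c := by
  simp only [cross, C.σ_algebraMap, C.σσ_of_T hc]
  linear_combination (algebraMap K F k * C.σ c) * two_eq_zero (F := F)

theorem T_mul_adj_add [CharP F 2] {c : F} (hc : C.T c = 0) (t : F) (k : K) :
    C.T (c * C.adj (t + algebraMap K F k)) = C.T (c * C.adj t) + k * C.T (c * t) := by
  have h2 := two_eq_zero (F := F)
  rw [ext_iff (F := F)]
  simp only [adj, C.algebraMap_T, map_add, map_mul, C.σ_three, C.σ_algebraMap, C.σσ_of_T hc]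
  grind

/-- In the two-dimensional space of trace zero elements, `c^⊥` is spanned by `c`. -/
theorem exists_eq_of_T_mul [CharP F 2] {c w : F} (hc0 : c ≠ 0) (hc : C.T c = 0)
    (h : C.T (c * w) = 0) : ∃ x y : K, w = algebraMap K F x + algebraMap K F y * c := by
  have h2 := two_eq_zero (F := F)
  have hm : C.T (w + algebraMap K F (C.T w)) = 0 := by
    rw [T_add, T_algebraMap, ext_iff (F := F), map_add, map_zero]
    linear_combination algebraMap K F (C.T w) * h2
  have hcm : C.T (c * (w + algebraMap K F (C.T w))) = 0 := by
    rw [mul_add, T_add, h, mul_comm c, T_smul, hc]; ring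
  set m := w + algebraMap K F (C.T w) with hmdef
  have hsc : C.σ c ≠ 0 := fun h => hc0 (C.σ_eq_zero.1 h)
  have hfix : C.σ (m / c) = m / c := by
    rw [map_div₀, div_eq_div_iff hsc hc0]
    have := C.algebraMap_T (c * m)
    rw [hcm, map_zero] at this
    simp only [map_mul, C.σσ_of_T hc, C.σσ_of_T hm] at this
    grind
  obtain ⟨y, hy⟩ := C.fixed _ hfix
  refine ⟨C.T w, y, ?_⟩
  rw [hy, div_mul_cancel₀ _ hc0, hmdef]
  linear_combination (-algebraMap K F (C.T w)) * h2

theorem lin_injective [CharP F 2] {c : F} (hc0 : c ≠ 0) (hc : C.T c = 0) {x y x' y' : K}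
    (h : algebraMap K F x + algebraMap K F y * c = algebraMap K F x' + algebraMap K F y' * c) :
    x = x' ∧ y = y' := by
  have hx : x = x' := by
    have := congrArg C.T h
    simpa [T_add, T_algebraMap, T_smul, hc] using this
  refine ⟨hx, ?_⟩
  subst hx
  rw [ext_iff (F := F)]
  exact mul_right_cancel₀ hc0 (add_left_cancel h)

theorem T_mul_lin [CharP F 2] (β c : F) (x y : K) :
    C.T (β * (algebraMap K F x + algebraMap K F y * c)) = x * C.T β + y * C.T (β * c) := by
  rw [ext_iff (F := F)]
  simp only [C.algebraMap_T, map_add, map_mul, C.σ_algebraMap]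
  ring

theorem T_mul_adj_lin [CharP F 2] {c : F} (hc : C.T c = 0) (γ : F) (x y : K) :
    C.T (γ * C.adj (algebraMap K F x + algebraMap K F y * c)) =
      x ^ 2 * C.T γ + x * y * C.T (γ * c) + y ^ 2 * C.T (γ * C.adj c) := by
  have h2 := two_eq_zero (F := F)
  rw [ext_iff (F := F)]
  simp only [adj, C.algebraMap_T, map_add, map_mul, map_pow, C.σ_algebraMap, C.σσ_of_T hc]
  grind

theorem N_lin [CharP F 2] {c : F} (hc : C.T c = 0) (x y : K) :
    C.N (algebraMap K F x + algebraMap K F y * c) =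
      x ^ 3 + x * y ^ 2 * C.T (C.adj c) + y ^ 3 * C.N c := by
  have h2 := two_eq_zero (F := F)
  rw [ext_iff (F := F)]
  simp only [adj, C.algebraMap_T, C.algebraMap_N, map_add, map_mul, map_pow, C.σ_algebraMap,
    C.σσ_of_T hc]
  grind

/-- This is the determinant of the linear system behind triple intersections; it shows that the
system is nonsingular. -/
theorem T_adj_det [CharP F 2] {c d e : F} (hc : C.T c = 0) (hd : C.T d = 0) (he : C.T e = 0) :
    C.T (c * d) * C.T (e * C.adj c) + C.T (c * e) * C.T (d * C.adj c) =
      C.T (d * e) * C.N c := by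
  have h2 := two_eq_zero (F := F)
  rw [ext_iff (F := F)]
  simp only [adj, C.algebraMap_T, C.algebraMap_N, map_add, map_mul, C.σσ_of_T hc, C.σσ_of_T hd,
    C.σσ_of_T he]
  grind

/-- Inversion reverses the coefficient vector `(a, β, γ, d)`. -/
theorem f_inv {a : K} {β γ : F} {d : K} {w : F} (hw : w ≠ 0) :
    C.N w * C.f a β γ d w⁻¹ = a + C.T (β * w) + C.T (γ * C.adj w) + d * C.N w := by
  have hN : C.N w ≠ 0 := fun h => hw (C.N_eq_zero.1 h)
  rw [f, T_mul_adj, T_mul_adj, N_inv, inv_inv]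
  field_simp

theorem exists_trace_zero_pair [CharP F 2] :
    ∃ a b : F, C.T a = 0 ∧ C.T b = 0 ∧ C.T (a * b) ≠ 0 := by
  have h2 := two_eq_zero (F := F)
  have key : ∀ x : F, C.T (x + algebraMap K F (C.T x)) = 0 := by
    intro x
    rw [T_add, T_algebraMap, ext_iff (F := F), map_add, map_zero]
    linear_combination algebraMap K F (C.T x) * h2
  obtain ⟨θ, hθ⟩ := C.exists_moved
  set a := θ + algebraMap K F (C.T θ)
  have ha : a ≠ 0 := by
    intro h
    apply hθ
    have : θ = algebraMap K F (C.T θ) := by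
      linear_combination h - algebraMap K F (C.T θ) * h2
    rw [this, C.σ_algebraMap]
  -- The second element is the trace zero part of `adj a`, because `T(a adj a) = N(a) ≠ 0`.
  refine ⟨a, _, key θ, key (C.adj a), ?_⟩
  rw [mul_add, T_add, T_adj_self, mul_comm a, T_smul, key θ, mul_zero, add_zero]
  exact fun h => ha (C.N_eq_zero.1 h)

end CyclicCubic
end OrthogonalSpreads

/-! ### Counting ovoid points perpendicular to singular points -/

namespace OrthogonalSpreads
namespace CyclicCubic

open Finset

set_option linter.unusedSectionVars false

theorem card_cubic_le {K : Type*} [Field K] [Fintype K] [DecidableEq K] {a b c d : K}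
    (h : a ≠ 0) : #{x : K | a * x ^ 3 + b * x ^ 2 + c * x + d = 0} ≤ 3 := by
  classical
  have hP : (⟨a, b, c, d⟩ : Cubic K).toPoly ≠ 0 := Cubic.ne_zero_of_a_ne_zero h
  calc _ ≤ #((⟨a, b, c, d⟩ : Cubic K).toPoly.roots.toFinset) := by
        apply card_le_card
        intro x hx
        rw [mem_filter] at hx
        rw [Multiset.mem_toFinset, Polynomial.mem_roots hP, Polynomial.IsRoot.def]
        simpa [Cubic.toPoly] using hx.2
    _ ≤ 3 := (Multiset.toFinset_card_le _).trans
        ((Polynomial.card_roots' _).trans (Cubic.natDegree_of_a_ne_zero h).le)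

theorem card_quadratic_le {K : Type*} [Field K] [Fintype K] [DecidableEq K] {b c d : K}
    (h : b ≠ 0 ∨ c ≠ 0 ∨ d ≠ 0) : #{x : K | b * x ^ 2 + c * x + d = 0} ≤ 2 := by
  classical
  have hP : (⟨0, b, c, d⟩ : Cubic K).toPoly ≠ 0 := by
    rcases h with h | h | h
    · exact Cubic.ne_zero_of_b_ne_zero h
    · exact Cubic.ne_zero_of_c_ne_zero h
    · exact Cubic.ne_zero_of_d_ne_zero h
  calc _ ≤ #((⟨0, b, c, d⟩ : Cubic K).toPoly.roots.toFinset) := by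
        apply card_le_card
        intro x hx
        rw [mem_filter] at hx
        rw [Multiset.mem_toFinset, Polynomial.mem_roots hP, Polynomial.IsRoot.def]
        simpa [Cubic.toPoly] using hx.2
    _ ≤ 2 := (Multiset.toFinset_card_le _).trans
        ((Polynomial.card_roots' _).trans Cubic.natDegree_of_a_eq_zero')

theorem card_filter_prod {K : Type*} [Fintype K] (P : K × K → Prop) [DecidablePred P] :
    #{p : K × K | P p} = ∑ y, #{x : K | P (x, y)} := by
  simp_rw [card_filter]
  rw [Fintype.sum_prod_type_right]

theorem sum_eq_of_forall_ne {K : Type*} [Fintype K] [DecidableEq K] {g : K → ℕ} {y₀ : K} {m n : ℕ}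
    (h₀ : g y₀ = m) (h : ∀ y, y ≠ y₀ → g y = n) : ∑ y, g y + n = m + Fintype.card K * n := by
  rw [← add_sum_erase _ _ (mem_univ y₀), sum_congr rfl (fun y hy => h y (ne_of_mem_erase hy)),
    h₀, sum_const, smul_eq_mul, add_assoc, ← Nat.succ_mul, Nat.succ_eq_add_one,
    card_erase_add_one (mem_univ _), card_univ]

variable {K F : Type*} [Field K] [Field F] [Algebra K F] (C : CyclicCubic K F)
variable [Fintype K] [Fintype F] [DecidableEq K] [DecidableEq F]

/-- The affine points of the ovoid perpendicular to the singular point with pole `κ` and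
direction `c`. -/
def Z (c κ : F) : Finset F := {t | C.T (c * C.adj (t + κ)) = 0}

theorem mem_Z {c κ t : F} : t ∈ C.Z c κ ↔ C.T (c * C.adj (t + κ)) = 0 := by simp [Z]

theorem card_T_fiber [CharP F 2] (hF : Fintype.card F = Fintype.card K ^ 3) {b : F} (hb : b ≠ 0)
    (v : K) : #{w : F | C.T (b * w) = v} = Fintype.card K ^ 2 := by
  have hv : ∀ v : K, #{w : F | C.T (b * w) = v} = #{w : F | C.T (b * w) = 0} := by
    intro v
    have h0 : C.T (b * (b⁻¹ * algebraMap K F v)) = v := by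
      rw [mul_inv_cancel_left₀ hb, T_algebraMap]
    refine card_bij' (fun w _ => w - b⁻¹ * algebraMap K F v) (fun w _ => w + b⁻¹ * algebraMap K F v)
      ?_ ?_ (by simp) (by simp)
    · intro w hw
      rw [mem_filter] at hw ⊢
      have := C.T_add (b * (w - b⁻¹ * algebraMap K F v)) (b * (b⁻¹ * algebraMap K F v))
      rw [h0, ← mul_add, sub_add_cancel, hw.2] at this
      exact ⟨mem_univ _, by simpa using this⟩
    · intro w hw
      rw [mem_filter] at hw ⊢
      rw [mul_add, T_add, h0, hw.2, zero_add]
      exact ⟨mem_univ _, rfl⟩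
  have hsum := card_eq_sum_card_fiberwise (s := (univ : Finset F)) (t := (univ : Finset K))
    (f := fun w => C.T (b * w)) (fun _ _ => by simp)
  rw [card_univ, hF, sum_congr rfl (fun u _ => (hv u).trans (hv v).symm), sum_const, card_univ,
    smul_eq_mul] at hsum
  exact Nat.eq_of_mul_eq_mul_left Fintype.card_pos (hsum.symm.trans (by ring))

variable [CharP F 2] [CharP K 2]

/-- After translation by `κ` and inversion, `Z c κ` becomes `c^⊥ = K + K c`, which gives coordinates
`(x, y)`. The convention `0⁻¹ = 0` makes the parametrization cover `t = κ` as well. -/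
theorem card_filter_Z {c : F} (hc0 : c ≠ 0) (hc : C.T c = 0) (κ : F) (P : F → Prop)
    [DecidablePred P] : #{t ∈ C.Z c κ | P t} =
      #{p : K × K | P ((algebraMap K F p.1 + algebraMap K F p.2 * c)⁻¹ + κ)} := by
  symm
  refine card_bij (fun p _ => (algebraMap K F p.1 + algebraMap K F p.2 * c)⁻¹ + κ) ?_ ?_ ?_
  · intro p hp
    rw [mem_filter] at hp ⊢
    refine ⟨?_, hp.2⟩
    rw [mem_Z, add_assoc, CharTwo.add_self_eq_zero, add_zero, T_mul_adj_eq_zero, inv_inv,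
      T_mul_lin, hc, C.T_sq hc]
    ring
  · intro p _ p' _ h
    have := C.lin_injective hc0 hc (inv_injective (add_right_cancel h))
    exact Prod.ext this.1 this.2
  · intro t ht
    rw [mem_filter, mem_Z, T_mul_adj_eq_zero] at ht
    obtain ⟨x, y, hxy⟩ := C.exists_eq_of_T_mul hc0 hc ht.1
    have htt : (algebraMap K F x + algebraMap K F y * c)⁻¹ + κ = t := by
      rw [← hxy, inv_inv, add_assoc, CharTwo.add_self_eq_zero, add_zero]
    exact ⟨(x, y), by rw [mem_filter, htt]; exact ⟨mem_univ _, ht.2⟩, htt⟩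

theorem card_Z {c : F} (hc0 : c ≠ 0) (hc : C.T c = 0) (κ : F) :
    #(C.Z c κ) = Fintype.card K ^ 2 := by
  have := C.card_filter_Z hc0 hc κ (fun _ => True)
  simp only [filter_true] at this
  rw [this, card_univ, Fintype.card_prod, sq]

theorem T_mul_adj_param_eq_zero {c d : F} (hc0 : c ≠ 0) (hc : C.T c = 0)
    (hd : C.T d = 0) (k l x y : K) :
    C.T (d * C.adj ((algebraMap K F x + algebraMap K F y * c)⁻¹ + algebraMap K F k
      + algebraMap K F l)) = 0 ↔
    y * (C.T (c * d) * (1 + (k + l) * x) + (k + l) * y * C.T (d * C.adj c)) = 0 := by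
  set w := algebraMap K F x + algebraMap K F y * c with hw
  rw [add_assoc, ← map_add, C.T_mul_adj_add hd]
  by_cases h0 : w = 0
  · have hy : y = 0 := (C.lin_injective hc0 hc (x' := 0) (y' := 0) (by simpa using h0)).2
    simp [h0, hy, adj_zero, T_zero]
  · have hN : C.N w ≠ 0 := fun h => h0 (C.N_eq_zero.1 h)
    rw [← mul_right_inj' hN, mul_zero, mul_add, mul_left_comm, T_mul_adj, N_inv, inv_inv,
      mul_inv_cancel_left₀ hN, ← T_mul_adj, hw, T_mul_lin, C.T_mul_adj_lin hc, hd, mul_comm d c]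
    ring_nf

/-- In the coordinates of `card_filter_Z` the second condition is `y` times a linear form: the line
`y = 0` gives `q` points and every other `y` exactly one. -/
theorem card_Z_inter_Z {c d : F} (hc0 : c ≠ 0) (hc : C.T c = 0) (hd : C.T d = 0)
    (hcd : C.T (c * d) ≠ 0) {k l : K} (hkl : k ≠ l) :
    #{t ∈ C.Z c (algebraMap K F k) | t ∈ C.Z d (algebraMap K F l)} + 1 = 2 * Fintype.card K := by
  have hm : k + l ≠ 0 := fun h => hkl (CharTwo.add_eq_zero.1 h)
  rw [C.card_filter_Z hc0 hc]
  simp_rw [mem_Z, C.T_mul_adj_param_eq_zero hc0 hc hd]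
  rw [card_filter_prod, sum_eq_of_forall_ne (y₀ := 0) (m := Fintype.card K) (n := 1)]
  · ring
  · simp
  · intro y hy
    rw [card_eq_one]
    refine ⟨-(C.T (c * d) + (k + l) * y * C.T (d * C.adj c)) / ((k + l) * C.T (c * d)), ?_⟩
    ext x
    simp only [mem_filter, mem_univ, true_and, mem_singleton, mul_eq_zero, hy, false_or]
    rw [eq_div_iff (mul_ne_zero hm hcd)]
    constructor <;> intro h <;> linear_combination h

theorem card_Z_inter_Z_inter_Z {c d e : F} (hc0 : c ≠ 0) (hc : C.T c = 0) (hd : C.T d = 0)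
    (he : C.T e = 0) (hcd : C.T (c * d) ≠ 0) (hce : C.T (c * e) ≠ 0) (hde : C.T (d * e) ≠ 0)
    {k l m : K} (hkl : k ≠ l) (hkm : k ≠ m) (hlm : l ≠ m) :
    #{t ∈ C.Z c (algebraMap K F k) | t ∈ C.Z d (algebraMap K F l) ∧
      t ∈ C.Z e (algebraMap K F m)} = Fintype.card K + 1 := by
  have hl : k + l ≠ 0 := fun h => hkl (CharTwo.add_eq_zero.1 h)
  have hm : k + m ≠ 0 := fun h => hkm (CharTwo.add_eq_zero.1 h)
  have hn : l + m ≠ 0 := fun h => hlm (CharTwo.add_eq_zero.1 h)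
  have hN : C.N c ≠ 0 := fun h => hc0 (C.N_eq_zero.1 h)
  have hdet := C.T_adj_det hc hd he
  have h2 : (2 : K) = 0 := CharTwo.two_eq_zero
  rw [C.card_filter_Z hc0 hc]
  simp_rw [mem_Z, C.T_mul_adj_param_eq_zero hc0 hc hd, C.T_mul_adj_param_eq_zero hc0 hc he]
  generalize C.T (c * d) = A at *
  generalize C.T (c * e) = B at *
  generalize C.T (d * C.adj c) = D at *
  generalize C.T (e * C.adj c) = E at *
  have hΔ : A * E + B * D ≠ 0 := by rw [hdet]; exact mul_ne_zero hde hN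
  generalize hlk : k + l = u at *
  generalize hmk : k + m = v at *
  have huv : u + v ≠ 0 := by
    rw [← hlk, ← hmk]
    convert hn using 1
    linear_combination k * h2
  have hden : u * v * (A * E + B * D) ≠ 0 := mul_ne_zero (mul_ne_zero hl hm) hΔ
  -- Both conditions hold on the line `y = 0`. Off it there remain two linear equations, solved by
  -- Cramer's rule with a determinant nonzero by `T_adj_det`.
  have key : (univ.filter fun p : K × K => p.2 * (A * (1 + u * p.1) + u * p.2 * D) = 0 ∧
      p.2 * (B * (1 + v * p.1) + v * p.2 * E) = 0) =
      insert ((E * A * v + D * B * u) / (u * v * (A * E + B * D)),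
        A * B * (u + v) / (u * v * (A * E + B * D)))
      (univ.map ⟨fun x : K => (x, (0 : K)), Prod.mk_left_injective 0⟩) := by
    ext ⟨x, y⟩
    simp only [mem_filter, mem_univ, true_and, mem_insert, Prod.mk.injEq, mem_map,
      Function.Embedding.coeFn_mk, exists_eq_left, mul_eq_zero]
    rw [eq_div_iff hden, eq_div_iff hden]
    constructor
    · rintro ⟨h₁, h₃⟩
      by_cases hy : y = 0
      · exact Or.inr hy.symm
      · replace h₁ := h₁.resolve_left hy
        replace h₃ := h₃.resolve_left hy
        refine Or.inl ⟨?_, ?_⟩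
        · linear_combination E * v * h₁ + D * u * h₃ -
            (E * A * v + D * B * u + u * v * y * D * E) * h2
        · linear_combination B * v * h₁ + A * u * h₃ - (A * B * u * v * x + A * B * (u + v)) * h2
    · rintro (⟨hx, hy⟩ | hy)
      · refine ⟨Or.inr ?_, Or.inr ?_⟩
        · rw [← mul_right_inj' hden, mul_zero]
          linear_combination A * u * hx + u * D * hy +
            (A ^ 2 * E * u * v + A * B * D * u * v + A * B * D * u ^ 2) * h2
        · rw [← mul_right_inj' hden, mul_zero]
          linear_combination B * v * hx + v * E * hy +
            (A * B * E * u * v + B ^ 2 * D * u * v + A * B * E * v ^ 2) * h2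
      · exact ⟨Or.inl hy.symm, Or.inl hy.symm⟩
  rw [key, card_insert_of_notMem, card_map, card_univ]
  have : A * B * (u + v) / (u * v * (A * E + B * D)) ≠ 0 :=
    div_ne_zero (mul_ne_zero (mul_ne_zero hcd hce) huv) hden
  simp [this.symm]

theorem card_f_zero_add {a : K} {β γ : F} {d : K} (b : F) :
    #{t : F | C.f a β γ d t = 0} = #{t : F | C.f a β γ d (t + b) = 0} := by
  refine card_bij' (fun t _ => t - b) (fun t _ => t + b) ?_ ?_ (by simp) (by simp) <;>
  · intro t ht
    simpa using ht

/-- A singular point not perpendicular to `(0, c, 0, 0)` shares few perpendicular ovoid points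
with it. -/
theorem card_Z_inter_f_le {a : K} {β γ : F} {d : K} {c : F} (hc0 : c ≠ 0) (hc : C.T c = 0)
    (h : C.T (γ * c) ≠ 0) :
    #{t ∈ C.Z c 0 | C.f a β γ d t = 0} ≤ 3 * Fintype.card K := by
  rw [C.card_filter_Z hc0 hc]
  -- Clearing `N(w)` from `f(w⁻¹)` gives a cubic in `x` for each fixed `y`, with leading coefficient
  -- `d`.
  have key : ∀ x y : K, algebraMap K F x + algebraMap K F y * c ≠ 0 →
      C.f a β γ d ((algebraMap K F x + algebraMap K F y * c)⁻¹ + 0) = 0 →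
      d * x ^ 3 + C.T γ * x ^ 2 + (C.T β + y * C.T (γ * c) + d * y ^ 2 * C.T (C.adj c)) * x +
        (a + y * C.T (β * c) + y ^ 2 * C.T (γ * C.adj c) + d * y ^ 3 * C.N c) = 0 := by
    intro x y hw hf
    have := C.f_inv (a := a) (β := β) (γ := γ) (d := d) hw
    rw [add_zero] at hf
    rw [hf, mul_zero, T_mul_lin, C.T_mul_adj_lin hc, C.N_lin hc] at this
    linear_combination -this
  have hq : 1 ≤ Fintype.card K := Fintype.card_pos
  by_cases hd : d = 0
  · have hsub : (univ.filter fun p : K × K =>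
        C.f a β γ d ((algebraMap K F p.1 + algebraMap K F p.2 * c)⁻¹ + 0) = 0) ⊆
        insert 0 (univ.filter fun p : K × K => C.T γ * p.1 ^ 2 + (C.T β + p.2 * C.T (γ * c)) * p.1 +
          (a + p.2 * C.T (β * c) + p.2 ^ 2 * C.T (γ * C.adj c)) = 0) := by
      rintro ⟨x, y⟩ hp
      rw [mem_filter] at hp
      rw [mem_insert, mem_filter]
      by_cases hw : algebraMap K F x + algebraMap K F y * c = 0
      · left
        have := C.lin_injective hc0 hc (x' := 0) (y' := 0) (by simpa using hw)
        exact Prod.ext this.1 this.2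
      · right
        have := key x y hw hp.2
        rw [hd] at this
        exact ⟨mem_univ _, by linear_combination this⟩
    refine (card_le_card hsub).trans ((card_insert_le _ _).trans ?_)
    rw [card_filter_prod]
    -- When `d = 0` the linear coefficient vanishes for a single `y`, which may contribute `q`
    -- roots; the total is at most `1 + q + 2(q - 1) < 3q`, where the `1` accounts for `w = 0`.
    have hle : ∀ y : K, #{x : K | C.T γ * x ^ 2 + (C.T β + y * C.T (γ * c)) * x +
          (a + y * C.T (β * c) + y ^ 2 * C.T (γ * C.adj c)) = 0} ≤
        if y = - C.T β / C.T (γ * c) then Fintype.card K else 2 := by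
      intro y
      split_ifs with hy
      · exact card_le_univ _
      · refine card_quadratic_le (Or.inr (Or.inl fun h0 => hy ?_))
        rw [eq_div_iff h]
        linear_combination h0
    have h1 := sum_le_sum (s := univ) (fun y _ => hle y)
    have h3 := sum_eq_of_forall_ne (K := K)
      (g := fun y => if y = - C.T β / C.T (γ * c) then Fintype.card K else 2)
      (y₀ := - C.T β / C.T (γ * c)) (if_pos rfl) (fun y hy => if_neg hy)
    dsimp only at h1 h3 ⊢
    omega
  · have hsub : (univ.filter fun p : K × K =>
        C.f a β γ d ((algebraMap K F p.1 + algebraMap K F p.2 * c)⁻¹ + 0) = 0) ⊆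
        univ.filter fun p : K × K =>
          d * p.1 ^ 3 + C.T γ * p.1 ^ 2 +
            (C.T β + p.2 * C.T (γ * c) + d * p.2 ^ 2 * C.T (C.adj c)) * p.1 +
        (a + p.2 * C.T (β * c) + p.2 ^ 2 * C.T (γ * C.adj c) + d * p.2 ^ 3 * C.N c) = 0 := by
      rintro ⟨x, y⟩ hp
      rw [mem_filter] at hp ⊢
      -- The value `w = 0` stands for `t = 0`, where `f` equals `d ≠ 0`.
      refine ⟨mem_univ _, key x y (fun hw => hd ?_) hp.2⟩
      simpa [hw, f, T_zero, N_zero, adj_zero] using hp.2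
    refine (card_le_card hsub).trans ?_
    rw [card_filter_prod]
    refine (sum_le_sum (g := fun _ => 3) fun y _ => ?_).trans
      (by rw [sum_const, card_univ, smul_eq_mul, mul_comm])
    exact card_cubic_le (b := C.T γ)
      (c := C.T β + y * C.T (γ * c) + d * y ^ 2 * C.T (C.adj c))
      (d := a + y * C.T (β * c) + y ^ 2 * C.T (γ * C.adj c) + d * y ^ 3 * C.N c) hd

theorem exists_sq_mul_eq {n v : K} (hn : n ≠ 0) : ∃ x : K, x ^ 2 * n = v := by
  obtain ⟨x, hx⟩ := FiniteField.isSquare_of_char_two (ringChar.eq K 2) (v / n)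
  exact ⟨x, by rw [sq, ← hx, div_mul_cancel₀ _ hn]⟩

theorem card_T_mul_adj_zero (hF : Fintype.card F = Fintype.card K ^ 3) {b : F} (hb : b ≠ 0) :
    #{t : F | C.T (b * C.adj t) = 0} = Fintype.card K ^ 2 := by
  rw [← C.card_T_fiber hF hb 0]
  refine card_bij' (fun t _ => t⁻¹) (fun t _ => t⁻¹) ?_ ?_ (by simp) (by simp) <;>
  · intro t ht
    simpa [T_mul_adj_eq_zero] using ht

theorem le_card_f_zero_of_ne {a : K} {γ : F} (hF : Fintype.card F = Fintype.card K ^ 3)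
    (ha : a ≠ 0) (hγ : γ ≠ 0) : Fintype.card K ^ 2 ≤ #{t : F | C.f a 0 γ 0 t = 0} := by
  have h2 := two_eq_zero (F := F)
  have hN : C.N γ ≠ 0 := fun h => hγ (C.N_eq_zero.1 h)
  -- The scalar is chosen so that `b = x adj γ` satisfies `a adj b = γ`. Then `b` is a zero of `f`,
  -- and expanding at `b` and inverting leaves the affine equation `T(b w) = 1`.
  obtain ⟨x, hx⟩ := exists_sq_mul_eq (v := 1) (mul_ne_zero ha hN)
  have hx0 : x ≠ 0 := by rintro rfl; simp at hx
  set b := algebraMap K F x * C.adj γ with hb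
  have hb0 : b ≠ 0 := mul_ne_zero (by simpa using hx0) (by simpa [adj_eq_zero] using hγ)
  have hab : algebraMap K F a * C.adj b = γ := by
    rw [hb, adj_mul, adj_algebraMap, adj_adj]
    have := congrArg (algebraMap K F) hx
    simp only [map_mul, map_pow, map_one] at this
    linear_combination γ * this
  have hfb : C.f a 0 γ 0 b = 0 := by
    rw [f, zero_mul, T_zero, ← hab, mul_assoc, T_smul, mul_comm _ b, T_adj_self]
    linear_combination a * C.N b * (CharTwo.two_eq_zero : (2 : K) = 0)
  rw [← C.card_T_fiber hF hb0 1]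
  refine card_le_card_of_injOn (fun w => w⁻¹ + b) ?_ ?_
  · intro w hw
    simp only [coe_filter, mem_univ, true_and, Set.mem_ofPred_eq] at hw ⊢
    have hw0 : w ≠ 0 := by rintro rfl; simp [T_zero] at hw
    have hNw : C.N w ≠ 0 := fun h => hw0 (C.N_eq_zero.1 h)
    rw [f_add, hfb, hab, ← mul_right_inj' hNw, C.f_inv hw0, mul_zero]
    have h0 : γ + C.cross 0 b + γ = 0 := by
      simp only [cross, map_zero]; linear_combination γ * h2
    rw [h0, zero_mul, T_zero, zero_add, mul_assoc, T_smul, hw]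
    linear_combination a * (CharTwo.two_eq_zero : (2 : K) = 0)
  · intro w _ w' _ h
    exact inv_injective (add_right_cancel h)

/-- A singular point outside the ovoid is perpendicular to many affine points of the ovoid. -/
theorem le_card_f_zero {a : K} {β γ : F} {d : K} (hF : Fintype.card F = Fintype.card K ^ 3)
    (hs : a * d = C.T (β * γ)) (h1 : a ≠ 0 → algebraMap K F a * γ ≠ C.adj β)
    (h2 : a = 0 → β ≠ 0 ∨ γ ≠ 0) : Fintype.card K ^ 2 ≤ #{t : F | C.f a β γ d t = 0} := by
  have t2 := two_eq_zero (F := F)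
  have t2' : (2 : K) = 0 := CharTwo.two_eq_zero
  by_cases ha : a = 0
  · subst ha
    by_cases hβ : β = 0
    · subst hβ
      rw [← C.card_T_fiber hF ((h2 rfl).resolve_left (by simp)) d]
      refine card_le_card fun t ht => ?_
      rw [mem_filter] at ht ⊢
      refine ⟨mem_univ _, ?_⟩
      rw [f, ht.2, zero_mul, zero_mul, T_zero]
      linear_combination d * t2'
    · have hN : C.N β ≠ 0 := fun h => hβ (C.N_eq_zero.1 h)
      -- As `T(βγ) = 0`, `cross_cross` shows that translating by `b₀` kills the linear term. A
      -- further shift by `x β` adds `x² N(β)`, which kills the constant since every element of `K`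
      -- is a square.
      set b₀ := C.cross β⁻¹ γ
      have hb₀ : C.cross β b₀ = γ := by
        have hT := C.T_algebraMap 1
        rw [map_one] at hT
        rw [cross_cross, ← hs, mul_inv_cancel₀ hβ, hT]; simp
      obtain ⟨x, hx⟩ := exists_sq_mul_eq (v := C.f 0 β γ d b₀) hN
      have hcr : γ + C.cross β (algebraMap K F x * β + b₀) = 0 := by
        rw [cross_add, hb₀]
        simp only [cross, map_mul, C.σ_algebraMap]
        linear_combination (γ + algebraMap K F x * C.σ β * C.σ (C.σ β)) * t2
      have hfb : C.f 0 β γ d (algebraMap K F x * β + b₀) = 0 := by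
        rw [f_add, hb₀, ← hx, f]
        have h0 : γ + γ + algebraMap K F 0 * C.adj b₀ = 0 := by
          rw [map_zero]; linear_combination γ * t2
        rw [h0, map_zero, zero_mul, zero_mul, zero_mul, T_zero, add_zero, add_zero, adj_mul,
          adj_algebraMap,
          mul_left_comm, ← map_pow, T_smul, T_adj_self]
        linear_combination x ^ 2 * C.N β * t2'
      rw [card_f_zero_add (b := algebraMap K F x * β + b₀), ← C.card_T_mul_adj_zero hF hβ]
      refine card_le_card fun t ht => ?_
      rw [mem_filter] at ht ⊢
      refine ⟨mem_univ _, ?_⟩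
      rw [f_add, hfb, hcr, f]
      simp [T_zero, ht.2]
  · have had : algebraMap K F a * algebraMap K F a⁻¹ = 1 := by
      rw [← map_mul, mul_inv_cancel₀ ha, map_one]
    -- Translating by `β / a` leaves `a N(t)` plus a linear term, the constant vanishing by
    -- singularity. The linear term is nonzero because the point is off the ovoid.
    set b := algebraMap K F a⁻¹ * β with hb
    have hab : algebraMap K F a * b = β := by rw [hb, ← mul_assoc, had, one_mul]
    have hcr : C.cross β b = 0 := by
      simp only [hb, cross, map_mul, C.σ_algebraMap]
      linear_combination (algebraMap K F a⁻¹ * C.σ β * C.σ (C.σ β)) * t2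
    have hfb : C.f a β γ d b = 0 := by
      have hγb : a * C.T (γ * b) = a * d := by
        rw [hs, ← T_smul, ← hab]; ring_nf
      rw [← mul_right_inj' ha, mul_zero, f, ← hab, mul_assoc, T_smul, T_adj_self]
      linear_combination hγb + (a * d + a ^ 2 * C.N b) * t2'
    rw [card_f_zero_add (b := b)]
    simp_rw [f_add, hfb, hab, hcr, CharTwo.add_self_eq_zero, add_zero]
    refine C.le_card_f_zero_of_ne hF ha fun h0 => h1 ha ?_
    have h3 : algebraMap K F a * C.adj b = γ := by linear_combination h0 - γ * t2
    have h4 := congrArg C.adj hab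
    rw [C.adj_mul (algebraMap K F a) b, adj_algebraMap] at h4
    linear_combination h4 - algebraMap K F a * h3

end CyclicCubic
end OrthogonalSpreads

/-! ### The affine model and the exchange argument -/

namespace OrthogonalSpreads
namespace CyclicCubic

open Finset

set_option linter.unusedSectionVars false

variable {K F : Type*} [Field K] [Field F] [Algebra K F] (C : CyclicCubic K F)
variable [CharP F 2] [CharP K 2]

/-- The hyperbolic quadratic form `(x, y) ↦ T(xy)` on `F × F`. -/
def form (e : F × F) : K := C.T (e.1 * e.2)

/-- The affine coordinates of a point of the ovoid. -/
def ovoidPoint (r : F) : F × F := (r⁻¹, C.adj r⁻¹)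

/-- The affine coordinates of the singular point with pole `κ` and direction `c`. -/
def outerPoint (c κ : F) : F × F :=
  (C.cross c κ * algebraMap K F (C.T (c * C.adj κ))⁻¹,
    c * algebraMap K F (C.T (c * C.adj κ))⁻¹)

theorem form_zero : C.form 0 = 0 := by simp [form, T_zero]

/-- An affine point `e` stands for the singular vector `(form e, e.2, e.1, 1)`, and singular
differences correspond to perpendicularity. -/
theorem form_add_ovoidPoint (e : F × F) {r : F} (hr : r ≠ 0) :
    C.N r * C.form (e + C.ovoidPoint r) = C.f (C.form e) e.2 e.1 1 r := by
  have h1 : C.adj r⁻¹ * algebraMap K F (C.N r) = r := by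
    rw [adj_inv, ← mul_adj]
    have := (C.adj_eq_zero (x := r)).not.2 hr
    field_simp
  have h3 : r⁻¹ * algebraMap K F (C.N r) = C.adj r := by
    rw [← mul_adj]; field_simp
  have h4 : algebraMap K F (C.N r) * ((e + C.ovoidPoint r).1 * (e + C.ovoidPoint r).2) =
      algebraMap K F (C.N r) * (e.1 * e.2) + e.2 * C.adj r + e.1 * r + algebraMap K F 1 := by
    have h5 : C.adj r⁻¹ * C.adj r = 1 := by
      rw [adj_inv, inv_mul_cancel₀ ((C.adj_eq_zero (x := r)).not.2 hr)]
    simp only [ovoidPoint, Prod.fst_add, Prod.snd_add, map_one]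
    linear_combination e.1 * h1 + e.2 * h3 + C.adj r⁻¹ * h3 + h5
  rw [form, form, f, ← T_smul, h4, T_add, T_add, T_add, T_algebraMap, T_smul]
  ring

theorem form_add_outerPoint (e : F × F) {c κ : F} (hD : C.T (c * C.adj κ) ≠ 0) :
    C.T (c * C.adj κ) * C.form (e + C.outerPoint c κ) =
      C.T ((e.1 + C.cross e.2 κ + algebraMap K F (C.form e) * C.adj κ) * c) := by
  set D := C.T (c * C.adj κ) with hDdef
  have hDD : algebraMap K F D * algebraMap K F D⁻¹ = 1 := by
    rw [← map_mul, mul_inv_cancel₀ hD, map_one]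
  have h4 : algebraMap K F D * ((e + C.outerPoint c κ).1 * (e + C.outerPoint c κ).2) =
      algebraMap K F D * (e.1 * e.2) + e.2 * C.cross c κ + e.1 * c +
        algebraMap K F D⁻¹ * (c * C.cross c κ) := by
    simp only [outerPoint, Prod.fst_add, Prod.snd_add, ← hDdef]
    linear_combination (e.1 * c + e.2 * C.cross c κ +
      algebraMap K F D⁻¹ * (c * C.cross c κ)) * hDD
  rw [form, form, ← T_smul, h4, T_add, T_add, T_add, T_smul, T_smul, T_mul_cross_self, T_mul_cross,
    add_mul, add_mul, T_add, T_add, mul_assoc, T_smul, mul_comm (C.adj κ), ← hDdef,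
    mul_comm (C.cross e.2 κ)]
  ring

theorem form_ovoidPoint (r : F) : C.form (C.ovoidPoint r) = (C.N r)⁻¹ := by
  rw [form, ovoidPoint, T_adj_self, N_inv]

/-- The ovoid points `r` and `s` pair to `N(r + s)`, so distinct ones are never perpendicular. -/
theorem f_form_ovoidPoint {r s : F} (hs : s ≠ 0) :
    C.N s * C.f (C.form (C.ovoidPoint s)) (C.ovoidPoint s).2 (C.ovoidPoint s).1 1 r =
      C.N (r + s) := by
  have hs' := C.N_eq_zero.not.2 hs
  have h0 := (C.adj_eq_zero (x := s)).not.2 hs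
  have h1 : C.adj s⁻¹ = algebraMap K F (C.N s)⁻¹ * s := by
    rw [adj_inv, map_inv₀, ← mul_adj]; field_simp
  have h2 : s⁻¹ = algebraMap K F (C.N s)⁻¹ * C.adj s := by
    rw [map_inv₀, ← mul_adj]; field_simp
  rw [form_ovoidPoint, f]
  simp only [ovoidPoint]
  rw [h1, h2, mul_assoc, mul_assoc, T_smul, T_smul]
  field_simp
  rw [ext_iff (F := F)]
  simp only [adj, C.algebraMap_N, C.algebraMap_T, map_add, map_mul, C.σ_three]
  ring

theorem form_ovoidPoint_add_ne {r s : F} (hr : r ≠ 0) (hs : s ≠ 0) (hrs : r ≠ s) :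
    C.form (C.ovoidPoint r + C.ovoidPoint s) ≠ 0 := by
  intro h
  have h1 := C.form_add_ovoidPoint (C.ovoidPoint r) hs
  have h3 := C.f_form_ovoidPoint (r := s) hr
  rw [← h1, h, mul_zero, mul_zero, eq_comm, N_eq_zero] at h3
  exact hrs (CharTwo.add_eq_zero.1 h3).symm

theorem form_outerPoint {c κ : F} : C.form (C.outerPoint c κ) = 0 := by
  rw [form, outerPoint, show C.cross c κ * algebraMap K F (C.T (c * C.adj κ))⁻¹ *
    (c * algebraMap K F (C.T (c * C.adj κ))⁻¹) = algebraMap K F ((C.T (c * C.adj κ))⁻¹ ^ 2) *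
    (c * C.cross c κ) by rw [map_pow]; ring, T_smul, T_mul_cross_self, mul_zero]

theorem form_ovoidPoint_add_outerPoint {r c κ : F} (hr : r ≠ 0) (hD : C.T (c * C.adj κ) ≠ 0) :
    C.N r * C.T (c * C.adj κ) * C.form (C.ovoidPoint r + C.outerPoint c κ) =
      C.T (c * C.adj (r + κ)) := by
  have h1 := C.form_add_ovoidPoint (C.outerPoint c κ) hr
  have h3 : C.T (C.cross c κ * r) = C.T (c * C.cross r κ) := by
    rw [mul_comm, T_mul_cross]
  rw [add_comm, mul_comm (C.N r), mul_assoc, h1, form_outerPoint, f, outerPoint]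
  dsimp only
  generalize hE : C.T (c * C.adj κ) = D at *
  have h5 : C.T (c * C.adj (r + κ)) = C.T (c * C.adj r) + C.T (c * C.cross r κ) + D := by
    rw [adj_add, mul_add, mul_add, T_add, T_add, hE]
  rw [show c * algebraMap K F D⁻¹ * C.adj r = algebraMap K F D⁻¹ * (c * C.adj r) by ring,
    show C.cross c κ * algebraMap K F D⁻¹ * r = algebraMap K F D⁻¹ * (C.cross c κ * r) by ring,
    T_smul, T_smul, h3, h5]
  field_simp
  ring

theorem form_outerPoint_add_outerPoint {c d κ : F} {k : K} (hc : C.T c = 0)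
    (hD : C.T (c * C.adj κ) ≠ 0) (hE : C.T (d * C.adj (κ + algebraMap K F k)) ≠ 0) :
    C.T (c * C.adj κ) * C.T (d * C.adj (κ + algebraMap K F k)) *
      C.form (C.outerPoint c κ + C.outerPoint d (κ + algebraMap K F k)) = k * C.T (c * d) := by
  have h1 := C.form_add_outerPoint (C.outerPoint c κ) hE
  rw [mul_assoc, h1, form_outerPoint, map_zero, zero_mul, add_zero, outerPoint]
  dsimp only
  have h2 : C.cross (c * algebraMap K F (C.T (c * C.adj κ))⁻¹) (κ + algebraMap K F k) =
      algebraMap K F (C.T (c * C.adj κ))⁻¹ * (C.cross c κ + algebraMap K F k * c) := by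
    rw [← C.cross_algebraMap hc, ← cross_add]
    simp only [cross, map_mul, C.σ_algebraMap]
    ring
  rw [h2, show (C.cross c κ * algebraMap K F (C.T (c * C.adj κ))⁻¹ +
    algebraMap K F (C.T (c * C.adj κ))⁻¹ * (C.cross c κ + algebraMap K F k * c)) * d =
    algebraMap K F (C.T (c * C.adj κ))⁻¹ * (algebraMap K F k * (c * d)) by
      linear_combination (algebraMap K F (C.T (c * C.adj κ))⁻¹ * C.cross c κ * d) *
        two_eq_zero (F := F), T_smul, T_smul]
  field_simp

variable [Fintype K] [Fintype F] [DecidableEq K] [DecidableEq F]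

/-- The affine points of the ovoid perpendicular to one of a family of singular points. -/
def removed (I : Finset K) (c : K → F) : Finset F := I.biUnion fun k => C.Z (c k) (algebraMap K F k)

/-- Some ovoid point `t₀` survives and is made the new point at infinity, so it is not counted in
`A`. The old point at infinity becomes `0 ∈ F × F` and is lost, being perpendicular to every new
point. -/
theorem exists_maximal_family (hF : Fintype.card F = Fintype.card K ^ 3) (I : Finset K) (c : K → F)
    (hI : I.Nonempty) (hc : ∀ k ∈ I, C.T (c k) = 0) (hc0 : ∀ k ∈ I, c k ≠ 0)
    (hcc : ∀ k ∈ I, ∀ l ∈ I, k ≠ l → C.T (c k * c l) ≠ 0) (hs : 3 * #I < Fintype.card K) :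
    ∃ A : Finset (F × F), #A + 1 + #(C.removed I c) = Fintype.card K ^ 3 + #I ∧
      (∀ x ∈ A, ∀ y ∈ A, x ≠ y → C.form (x - y) ≠ 0) ∧ ∀ x, ∃ y ∈ A, C.form (x - y) = 0 := by
  have hq : 0 < Fintype.card K := Fintype.card_pos
  -- At most `s q² < q³` points are removed.
  obtain ⟨t₀, ht₀⟩ : ∃ t₀, t₀ ∉ C.removed I c := by
    by_contra! h
    have h1 : Fintype.card F ≤ #(C.removed I c) := by
      rw [← card_univ]; exact card_le_card fun t _ => h t
    have h2 : #(C.removed I c) ≤ #I * Fintype.card K ^ 2 :=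
      card_biUnion_le_card_mul _ _ _ fun k hk => (C.card_Z (hc0 k hk) (hc k hk) _).le
    rw [hF] at h1
    nlinarith [pow_pos hq 2]
  have hmem : ∀ t, t ∈ C.removed I c ↔
      ∃ k ∈ I, C.T (c k * C.adj (t + algebraMap K F k)) = 0 := by
    intro t; simp [removed, mem_Z]
  have hD : ∀ k ∈ I, C.T (c k * C.adj (t₀ + algebraMap K F k)) ≠ 0 := fun k hk h =>
    ht₀ ((hmem t₀).2 ⟨k, hk, h⟩)
  let J := {r : F // r ≠ 0 ∧ r + t₀ ∉ C.removed I c} ⊕ I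
  let e : J → F × F := Sum.elim (fun r => C.ovoidPoint r)
    (fun k => C.outerPoint (c k) (t₀ + algebraMap K F (k : K)))
  have hio : ∀ (r : {r : F // r ≠ 0 ∧ r + t₀ ∉ C.removed I c}) (k : I),
      C.form (e (Sum.inl r) + e (Sum.inr k)) ≠ 0 := by
    intro r k h
    have h1 := C.form_ovoidPoint_add_outerPoint r.2.1 (hD k k.2)
    simp only [e, Sum.elim_inl, Sum.elim_inr] at h
    rw [h, mul_zero, eq_comm, ← add_assoc] at h1
    exact r.2.2 ((hmem _).2 ⟨k, k.2, h1⟩)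
  have hadd : ∀ i j : J, i ≠ j → C.form (e i + e j) ≠ 0 := by
    rintro (r | k) (s | l) hij
    · exact C.form_ovoidPoint_add_ne r.2.1 s.2.1 fun h => hij (by rw [Subtype.ext h])
    · exact hio r l
    · rw [add_comm]; exact hio s k
    · intro h
      have hkl : (k : K) ≠ l := fun h => hij (by rw [Subtype.ext h])
      have hl : t₀ + algebraMap K F (l : K) =
          t₀ + algebraMap K F (k : K) + algebraMap K F (k + l : K) := by
        rw [map_add]; linear_combination (-algebraMap K F (k : K)) * two_eq_zero (F := F)
      have h1 := C.form_outerPoint_add_outerPoint (d := c l) (k := k + l) (hc k k.2) (hD k k.2)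
        (by rw [← hl]; exact hD l l.2)
      simp only [e, Sum.elim_inr] at h
      rw [← hl, h, mul_zero, eq_comm] at h1
      exact mul_ne_zero (fun h => hkl (CharTwo.add_eq_zero.1 h)) (hcc k k.2 l l.2 hkl) h1
  have hinj : Function.Injective e := by
    intro i j h
    by_contra hij
    apply hadd i j hij
    rw [h, CharTwo.add_self_eq_zero, form_zero]
  refine ⟨univ.image e, ?_, ?_, ?_⟩
  · rw [card_image_of_injective _ hinj, card_univ, Fintype.card_sum, Fintype.card_coe,
      Fintype.card_subtype]
    have h1 : (univ.filter fun r : F => r ≠ 0 ∧ r + t₀ ∉ C.removed I c) =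
        ((C.removed I c)ᶜ.map (addRightEmbedding t₀)).erase 0 := by
      ext r
      simp only [mem_filter, mem_univ, true_and, mem_erase, mem_map, mem_compl,
        addRightEmbedding_apply]
      refine and_congr_right fun _ => ⟨fun h => ⟨_, h, ?_⟩, ?_⟩
      · rw [add_assoc, CharTwo.add_self_eq_zero, add_zero]
      · rintro ⟨s, hs, rfl⟩
        rwa [add_assoc, CharTwo.add_self_eq_zero, add_zero]
    have h2 : (0 : F) ∈ (C.removed I c)ᶜ.map (addRightEmbedding t₀) := by
      rw [mem_map]
      exact ⟨t₀, mem_compl.2 ht₀, CharTwo.add_self_eq_zero _⟩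
    have h3 := card_erase_add_one h2
    rw [card_map, card_compl, hF] at h3
    have h4 := card_le_univ (C.removed I c)
    rw [h1]
    omega
  · simp only [mem_image, mem_univ, true_and]
    rintro _ ⟨i, rfl⟩ _ ⟨j, rfl⟩ hij
    rw [CharTwo.sub_eq_add]
    exact hadd i j fun h => hij (h ▸ rfl)
  · intro x
    simp only [mem_image, mem_univ, true_and, exists_exists_eq_and]
    by_contra! hx
    replace hx : ∀ j, C.form (x + e j) ≠ 0 := fun j => by
      rw [← CharTwo.sub_eq_add]; exact hx j
    have hk : ∀ k ∈ I, C.form (x + C.outerPoint (c k) (t₀ + algebraMap K F k)) ≠ 0 := fun k hk =>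
      hx (Sum.inr ⟨k, hk⟩)
    have hr : ∀ r : F, r ≠ 0 → r + t₀ ∉ C.removed I c → C.form (x + C.ovoidPoint r) ≠ 0 :=
      fun r h0 h1 => hx (Sum.inl ⟨r, h0, h1⟩)
    obtain ⟨k₀, hk₀⟩ := hI
    have hx0 : x ≠ 0 := by
      rintro rfl
      apply hk k₀ hk₀
      rw [zero_add, form_outerPoint]
    have hov : ∀ s, s ≠ 0 → x ≠ C.ovoidPoint s := by
      rintro s hs0 rfl
      by_cases hs1 : s + t₀ ∈ C.removed I c
      · obtain ⟨k, hkI, h⟩ := (hmem _).1 hs1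
        have h1 := C.form_ovoidPoint_add_outerPoint hs0 (hD k hkI)
        rw [← add_assoc, h] at h1
        exact mul_ne_zero (mul_ne_zero (C.N_eq_zero.not.2 hs0) (hD k hkI)) (hk k hkI) h1
      · apply hr s hs0 hs1
        rw [CharTwo.add_self_eq_zero, form_zero]
    have hlow := C.le_card_f_zero (a := C.form x) (β := x.2) (γ := x.1) (d := 1) hF
      -- A vector with `a γ = adj β` would be an ovoid point: the trace gives `N(β) = a²`, and
      -- applying `adj` then gives `β = adj γ`, that is, parameter `γ⁻¹`.
      (by rw [form, mul_one, mul_comm]) (by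
        intro ha h
        have h1 := C.mul_adj x.2
        rw [← h] at h1
        have h3 : C.N x.2 = C.form x ^ 2 := by
          have := congrArg C.T h1
          rw [T_algebraMap, mul_left_comm, T_smul, mul_comm x.2, ← form] at this
          rw [← this, sq]
        have h4 := congrArg C.adj h
        have haF : algebraMap K F (C.form x) ≠ 0 := by simpa using ha
        rw [adj_mul, adj_algebraMap, adj_adj, h3, map_pow] at h4
        have h5 := mul_left_cancel₀ (pow_ne_zero 2 haF) h4
        have h6 : x.1 ≠ 0 := fun h0 => ha (by rw [form, h0, zero_mul, T_zero])
        exact hov x.1⁻¹ (inv_ne_zero h6) (Prod.ext (inv_inv _).symm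
          (by rw [ovoidPoint, inv_inv, h5]))) (by
        intro _
        by_contra! h
        exact hx0 (Prod.ext h.2 h.1))
    have hup : #(univ.filter fun r => C.f (C.form x) x.2 x.1 1 r = 0) ≤
        #I * (3 * Fintype.card K) := by
      calc _ ≤ #(I.biUnion fun k => {r ∈ C.Z (c k) (t₀ + algebraMap K F k) |
            C.f (C.form x) x.2 x.1 1 r = 0}) := by
            refine card_le_card fun r hr0 => ?_
            rw [mem_filter] at hr0
            have hr1 : r ≠ 0 := by
              rintro rfl
              simp [f, N_zero, adj_zero, T_zero] at hr0
            by_cases hr2 : r + t₀ ∈ C.removed I c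
            · obtain ⟨k, hkI, h⟩ := (hmem _).1 hr2
              rw [mem_biUnion]
              refine ⟨k, hkI, mem_filter.2 ⟨?_, hr0.2⟩⟩
              rwa [mem_Z, ← add_assoc]
            · exfalso
              have h1 := C.form_add_ovoidPoint x hr1
              rw [hr0.2] at h1
              exact mul_ne_zero (C.N_eq_zero.not.2 hr1) (hr r hr1 hr2) h1
        _ ≤ _ := by
            refine card_biUnion_le_card_mul _ _ _ fun k hkI => ?_
            -- Translation by the pole `t₀ + k` brings the new point to pole `0`, and the
            -- coefficient tested by `card_Z_inter_f_le` becomes the pairing of `x` with that point.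
            have h1 := C.form_add_outerPoint x (hD k hkI)
            have h3 := C.card_Z_inter_f_le (hc0 k hkI) (hc k hkI) (a := C.form x)
              (γ := x.1 + C.cross x.2 (t₀ + algebraMap K F k) +
                algebraMap K F (C.form x) * C.adj (t₀ + algebraMap K F k)) (β := x.2 +
              algebraMap K F (C.form x) * (t₀ + algebraMap K F k))
              (d := C.f (C.form x) x.2 x.1 1 (t₀ + algebraMap K F k))
              (by rw [← h1]; exact mul_ne_zero (hD k hkI) (hk k hkI))
            have h5 := fun t => C.f_add (C.form x) x.2 x.1 1 t (t₀ + algebraMap K F k)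
            simp_rw [← h5] at h3
            refine le_trans (le_of_eq ?_) h3
            refine card_bij' (fun t _ => t - (t₀ + algebraMap K F k))
              (fun t _ => t + (t₀ + algebraMap K F k)) ?_ ?_ (by simp) (by simp) <;>
            · intro t ht
              simpa [mem_Z, CharTwo.sub_eq_add, add_assoc, CharTwo.add_self_eq_zero] using ht
    nlinarith

end CyclicCubic
end OrthogonalSpreads

/-! ### Conics of singular points and the number of removed points -/

namespace OrthogonalSpreads
namespace CyclicCubic

open Finset

set_option linter.unusedSectionVars false

variable {K F : Type*} [Field K] [Field F] [Algebra K F] (C : CyclicCubic K F)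
variable [CharP F 2] [CharP K 2]

/-- Points of the projective line of trace zero elements spanned by `a` and `b`. -/
def dir (a b : F) (k : K) : F := a + algebraMap K F k * b

variable {a b : F} (ha : C.T a = 0) (hb : C.T b = 0) (hab : C.T (a * b) ≠ 0)

include ha hb in
theorem T_dir (k : K) : C.T (dir a b k) = 0 := by
  rw [dir, T_add, T_smul, ha, hb]; ring

include ha hb in
theorem T_dir_mul_dir (k l : K) : C.T (dir a b k * dir a b l) = (k + l) * C.T (a * b) := by
  rw [dir, dir, show (a + algebraMap K F k * b) * (a + algebraMap K F l * b) =
    a * a + algebraMap K F (k + l) * (a * b) + algebraMap K F (k * l) * (b * b) by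
      rw [map_add, map_mul]; ring, T_add, T_add, T_smul, T_smul, C.T_sq ha, C.T_sq hb]
  ring

include ha hb hab in
theorem T_dir_mul_dir_ne {k l : K} (hkl : k ≠ l) : C.T (dir a b k * dir a b l) ≠ 0 := by
  rw [C.T_dir_mul_dir ha hb]
  exact mul_ne_zero (fun h => hkl (CharTwo.add_eq_zero.1 h)) hab

include ha hb hab in
theorem dir_ne_zero (k : K) : dir a b k ≠ 0 := by
  intro h
  have := C.T_dir_mul_dir_ne ha hb hab (k := k) (l := k + 1) (by simp)
  simp [h, T_zero] at this

include ha hb in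
theorem T_dir_mul_adj (j k : K) (t : F) : C.T (dir a b j * C.adj (t + algebraMap K F k)) =
    C.T (a * C.adj t) + (j * C.T (b * C.adj t) + k * C.T (a * t)) + j * k * C.T (b * t) := by
  rw [C.T_mul_adj_add (C.T_dir ha hb j), dir, add_mul, add_mul, T_add, T_add, mul_assoc, mul_assoc,
    T_smul, T_smul]
  ring

include ha hb hab in
theorem exists_eq_algebraMap {t : F} (h1 : C.T (a * t) = 0) (h2 : C.T (b * t) = 0) :
    ∃ k, algebraMap K F k = t := by
  have ha0 : a ≠ 0 := by rintro rfl; simp [T_zero] at hab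
  obtain ⟨x, y, rfl⟩ := C.exists_eq_of_T_mul ha0 ha h1
  rw [T_mul_lin, hb, mul_comm b a] at h2
  have hy : y = 0 := by simpa [hab] using h2
  exact ⟨x, by simp [hy]⟩

variable [Fintype K] [Fintype F] [DecidableEq K] [DecidableEq F]

/-- The affine points of the ovoid perpendicular to all singular points of the conic. -/
def common (a b : F) : Finset F := {t | ∀ k : K, t ∈ C.Z (dir a b k) (algebraMap K F k)}

include ha hb in
-- For fixed `t`, perpendicularity to the conic point `k` is a polynomial condition of degree at
-- most two in `k`; three roots make it vanish identically.
theorem mem_common_of_three {t : F} {k l m : K} (hkl : k ≠ l) (hkm : k ≠ m) (hlm : l ≠ m)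
    (hk : t ∈ C.Z (dir a b k) (algebraMap K F k)) (hl : t ∈ C.Z (dir a b l) (algebraMap K F l))
    (hm : t ∈ C.Z (dir a b m) (algebraMap K F m)) : t ∈ C.common a b := by
  by_contra hc
  have hco : C.T (b * t) ≠ 0 ∨ C.T (b * C.adj t) + C.T (a * t) ≠ 0 ∨ C.T (a * C.adj t) ≠ 0 := by
    by_contra! h
    apply hc
    rw [common, mem_filter]
    refine ⟨mem_univ _, fun k => ?_⟩
    rw [mem_Z, C.T_dir_mul_adj ha hb]
    linear_combination k ^ 2 * h.1 + k * h.2.1 + h.2.2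
  have h2 := card_quadratic_le hco
  have h3 : ({k, l, m} : Finset K) ⊆ univ.filter fun x => C.T (b * t) * x ^ 2 +
      (C.T (b * C.adj t) + C.T (a * t)) * x + C.T (a * C.adj t) = 0 := by
    intro x hx
    rw [mem_filter]
    refine ⟨mem_univ _, ?_⟩
    have hx' : t ∈ C.Z (dir a b x) (algebraMap K F x) := by
      simp only [mem_insert, mem_singleton] at hx
      rcases hx with rfl | rfl | rfl <;> assumption
    rw [mem_Z, C.T_dir_mul_adj ha hb] at hx'
    linear_combination hx'
  have h4 := card_le_card h3
  rw [card_eq_three.2 ⟨k, l, m, hkl, hkm, hlm, rfl⟩] at h4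
  omega

include ha hb hab in
theorem card_common (hq : 3 ≤ Fintype.card K) : #(C.common a b) = Fintype.card K + 1 := by
  obtain ⟨s, -, hs⟩ := exists_subset_card_eq (s := (univ : Finset K)) (n := 3) (by rwa [card_univ])
  obtain ⟨k, l, m, hkl, hkm, hlm, -⟩ := card_eq_three.1 hs
  rw [← C.card_Z_inter_Z_inter_Z (C.dir_ne_zero ha hb hab k) (C.T_dir ha hb k) (C.T_dir ha hb l)
    (C.T_dir ha hb m) (C.T_dir_mul_dir_ne ha hb hab hkl) (C.T_dir_mul_dir_ne ha hb hab hkm)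
    (C.T_dir_mul_dir_ne ha hb hab hlm) hkl hkm hlm]
  congr 1
  ext t
  rw [mem_filter]
  constructor
  · intro h
    rw [common, mem_filter] at h
    exact ⟨h.2 k, h.2 l, h.2 m⟩
  · rintro ⟨h1, h2, h3⟩
    exact C.mem_common_of_three ha hb hkl hkm hlm h1 h2 h3

theorem common_subset (k : K) : C.common a b ⊆ C.Z (dir a b k) (algebraMap K F k) := by
  intro t h
  rw [common, mem_filter] at h
  exact h.2 k

include ha hb hab in
theorem card_common_union_removed (hq : 3 ≤ Fintype.card K) (I : Finset K) :
    (#(C.common a b ∪ C.removed I (dir a b)) : ℤ) = Fintype.card K + 1 +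
      #I * ((Fintype.card K : ℤ) ^ 2 - Fintype.card K - 1) -
      ((#I).choose 2 : ℤ) * ((Fintype.card K : ℤ) - 2) := by
  have hC := C.card_common ha hb hab hq
  induction I using Finset.induction_on with
  | empty => simp [removed, hC]
  | insert k I hk ih =>
    have h1 : C.common a b ∪ C.removed (insert k I) (dir a b) =
        (C.common a b ∪ C.removed I (dir a b)) ∪ C.Z (dir a b k) (algebraMap K F k) := by
      rw [removed, biUnion_insert, ← removed, union_assoc, union_comm (C.Z _ _)]
    -- The new set meets the earlier union in `common` together with one piece of size `q - 2` for
    -- each earlier `l`; these pieces are disjoint by `mem_common_of_three`.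
    have h2 : (C.common a b ∪ C.removed I (dir a b)) ∩ C.Z (dir a b k) (algebraMap K F k) =
        C.common a b ∪ I.biUnion fun l => {t ∈ C.Z (dir a b k) (algebraMap K F k) |
          t ∈ C.Z (dir a b l) (algebraMap K F l)} \ C.common a b := by
      ext t
      have : t ∈ C.common a b → t ∈ C.Z (dir a b k) (algebraMap K F k) := fun h =>
        C.common_subset k h
      simp only [mem_inter, mem_union, removed, mem_biUnion, mem_sdiff, mem_filter]
      tauto
    have h3 : Disjoint (C.common a b) (I.biUnion fun l =>
        {t ∈ C.Z (dir a b k) (algebraMap K F k) |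
          t ∈ C.Z (dir a b l) (algebraMap K F l)} \ C.common a b) := by
      rw [disjoint_biUnion_right]
      exact fun l _ => disjoint_sdiff
    have h4 : ∀ l ∈ I, #({t ∈ C.Z (dir a b k) (algebraMap K F k) |
          t ∈ C.Z (dir a b l) (algebraMap K F l)} \ C.common a b) = Fintype.card K - 2 := by
      intro l hl
      have hkl : k ≠ l := fun h => hk (h ▸ hl)
      rw [card_sdiff_of_subset, hC]
      · have := C.card_Z_inter_Z (C.dir_ne_zero ha hb hab k) (C.T_dir ha hb k) (C.T_dir ha hb l)
          (C.T_dir_mul_dir_ne ha hb hab hkl) hkl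
        omega
      · exact fun t ht => mem_filter.2 ⟨C.common_subset k ht, C.common_subset l ht⟩
    have h5 := card_union_add_card_inter (C.common a b ∪ C.removed I (dir a b))
      (C.Z (dir a b k) (algebraMap K F k))
    rw [h2, card_union_of_disjoint h3, card_biUnion, sum_congr rfl h4, sum_const, smul_eq_mul, hC,
      C.card_Z (C.dir_ne_zero ha hb hab k) (C.T_dir ha hb k)] at h5
    · rw [h1, card_insert_of_notMem hk, Nat.choose_succ_succ' _ 1, Nat.choose_one_right]
      zify at h5
      rw [Nat.cast_sub (by omega)] at h5
      push_cast at h5 ⊢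
      linear_combination h5 + ih
    · intro l hl m hm hlm
      rw [Function.onFun, disjoint_left]
      intro t ht ht'
      simp only [mem_sdiff, mem_filter] at ht ht'
      exact ht.2 (C.mem_common_of_three ha hb (fun h => hk (by rwa [h]))
        (fun h => hk (by rwa [h])) hlm
        ht.1.1 ht.1.2 ht'.1.2)

include ha hb hab in
theorem card_removed (hq : 3 ≤ Fintype.card K) {I : Finset K} (hI : I.Nonempty) :
    (#(C.removed I (dir a b)) : ℤ) = Fintype.card K + 1 +
      #I * ((Fintype.card K : ℤ) ^ 2 - Fintype.card K - 1) -
      ((#I).choose 2 : ℤ) * ((Fintype.card K : ℤ) - 2) := by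
  rw [← C.card_common_union_removed ha hb hab hq, union_eq_right.2]
  obtain ⟨k, hk⟩ := hI
  exact (C.common_subset k).trans
    (subset_biUnion_of_mem (fun k => C.Z (dir a b k) (algebraMap K F k)) hk)

include ha hb hab in
-- Perpendicularity to all of the conic and to one point off it forces `T(a t) = T(b t) = 0`, hence
-- `t ∈ K`.
theorem common_inter_Z (hq : 3 ≤ Fintype.card K) {j k : K} (hjk : j ≠ k) :
    C.common a b ∩ C.Z (dir a b j) (algebraMap K F k) = univ.image (algebraMap K F) := by
  ext t
  rw [mem_inter, mem_image, common, mem_filter]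
  constructor
  · rintro ⟨⟨-, h⟩, h'⟩
    have h0 := h 0
    have h1 := h 1
    have hj := h j
    obtain ⟨x, -, hx⟩ : ∃ x ∈ (univ : Finset K), x ∉ ({0, 1} : Finset K) :=
      exists_mem_notMem_of_card_lt_card (by rw [card_pair zero_ne_one, card_univ]; omega)
    rw [mem_insert, mem_singleton, not_or] at hx
    have hx' := h x
    rw [mem_Z, C.T_dir_mul_adj ha hb] at h0 h1 hj hx' h'
    have hE : C.T (b * t) = 0 := by
      have : x * (x - 1) * C.T (b * t) = 0 := by linear_combination hx' - x * h1 + (x - 1) * h0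
      simpa [hx.1, sub_eq_zero, hx.2] using this
    have hD : C.T (a * t) = 0 := by
      have : (k - j) * C.T (a * t) = 0 := by
        rw [hE] at h' hj
        linear_combination h' - hj
      simpa [sub_eq_zero, hjk.symm] using this
    obtain ⟨l, hl⟩ := C.exists_eq_algebraMap ha hb hab hD hE
    exact ⟨l, mem_univ _, hl⟩
  · rintro ⟨l, -, rfl⟩
    simp_rw [mem_Z, ← map_add, adj_algebraMap, ← map_pow]
    have h : ∀ j m : K, C.T (dir a b j * algebraMap K F m) = 0 := by
      intro j m
      rw [mul_comm, T_smul, C.T_dir ha hb, mul_zero]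
    exact ⟨⟨mem_univ _, fun k => h _ _⟩, h _ _⟩

/-- Replacing one direction of a conic. -/
def dir' (a b : F) (j k : K) (l : K) : F := if l = k then dir a b j else dir a b l

include ha hb hab in
theorem card_removed_four (hq : 3 ≤ Fintype.card K) {k₁ k₂ k₃ k₄ j : K} (h₁₂ : k₁ ≠ k₂)
    (h₁₃ : k₁ ≠ k₃) (h₂₃ : k₂ ≠ k₃) (h₁₄ : k₁ ≠ k₄) (h₂₄ : k₂ ≠ k₄) (h₃₄ : k₃ ≠ k₄)
    (h₁ : k₁ ≠ j) (h₂ : k₂ ≠ j) (h₃ : k₃ ≠ j) (h₄ : k₄ ≠ j) :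
    (#(C.removed {k₁, k₂, k₃, k₄} (dir' a b j k₄)) : ℤ) =
      4 * (Fintype.card K : ℤ) ^ 2 - 9 * Fintype.card K + 10 := by
  have e₃ := C.card_removed ha hb hab hq (I := {k₁, k₂, k₃}) (by simp)
  rw [card_eq_three.2 ⟨k₁, k₂, k₃, h₁₂, h₁₃, h₂₃, rfl⟩] at e₃
  set Z₄ := C.Z (dir a b j) (algebraMap K F k₄)
  have hU : C.removed {k₁, k₂, k₃, k₄} (dir' a b j k₄) = C.removed {k₁, k₂, k₃} (dir a b) ∪ Z₄ := by
    ext t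
    simp [removed, dir', h₁₄, h₂₄, h₃₄, Z₄]
  have hc4 : #Z₄ = Fintype.card K ^ 2 := C.card_Z (C.dir_ne_zero ha hb hab j) (C.T_dir ha hb j) _
  have hp : ∀ {k : K}, k ≠ k₄ → k ≠ j →
      #(Z₄ ∩ C.Z (dir a b k) (algebraMap K F k)) + 1 = 2 * Fintype.card K := by
    intro k hk hkj
    rw [← filter_mem_eq_inter]
    exact C.card_Z_inter_Z (C.dir_ne_zero ha hb hab j) (C.T_dir ha hb j) (C.T_dir ha hb k)
      (C.T_dir_mul_dir_ne ha hb hab hkj.symm) hk.symm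
  have ht : ∀ {k l : K}, k ≠ k₄ → k ≠ j → l ≠ k₄ → l ≠ j → k ≠ l →
      #(Z₄ ∩ C.Z (dir a b k) (algebraMap K F k) ∩ (Z₄ ∩ C.Z (dir a b l) (algebraMap K F l))) =
        Fintype.card K + 1 := by
    intro k l hk hkj hl hlj hkl
    rw [← C.card_Z_inter_Z_inter_Z (C.dir_ne_zero ha hb hab j) (C.T_dir ha hb j) (C.T_dir ha hb k)
      (C.T_dir ha hb l) (C.T_dir_mul_dir_ne ha hb hab hkj.symm)
      (C.T_dir_mul_dir_ne ha hb hab hlj.symm) (C.T_dir_mul_dir_ne ha hb hab hkl) hk.symm hl.symm hkl]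
    congr 1
    ext t
    simp only [mem_inter, mem_filter, Z₄]
    tauto
  -- The fourfold intersection: three conic points force membership in `common`, which the point off
  -- the conic cuts down to `K`.
  have hquad : #(Z₄ ∩ C.Z (dir a b k₁) (algebraMap K F k₁) ∩
      (Z₄ ∩ C.Z (dir a b k₃) (algebraMap K F k₃)) ∩
      (Z₄ ∩ C.Z (dir a b k₂) (algebraMap K F k₂) ∩
      (Z₄ ∩ C.Z (dir a b k₃) (algebraMap K F k₃)))) = Fintype.card K := by
    rw [← card_univ, ← card_image_of_injective univ (algebraMap K F).injective,
      ← C.common_inter_Z ha hb hab hq h₄.symm]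
    congr 1
    ext t
    simp only [mem_inter, Z₄]
    constructor
    · intro h
      exact ⟨C.mem_common_of_three ha hb h₁₂ h₁₃ h₂₃ h.1.1.2 h.2.1.2 h.1.2.2, h.1.1.1⟩
    · intro h
      have := fun k => C.common_subset k h.1
      simp [this, h.2]
  have hI : C.removed {k₁, k₂, k₃} (dir a b) ∩ Z₄ =
      Z₄ ∩ C.Z (dir a b k₁) (algebraMap K F k₁) ∪ Z₄ ∩ C.Z (dir a b k₂) (algebraMap K F k₂) ∪
      Z₄ ∩ C.Z (dir a b k₃) (algebraMap K F k₃) := by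
    ext t
    simp only [removed, mem_inter, mem_union, mem_biUnion, mem_insert, mem_singleton,
      exists_eq_or_imp, exists_eq_left]
    tauto
  have f0 := card_union_add_card_inter (C.removed {k₁, k₂, k₃} (dir a b)) Z₄
  rw [hI] at f0
  have p₁ := hp h₁₄ h₁
  have p₂ := hp h₂₄ h₂
  have p₃ := hp h₃₄ h₃
  have t₁₂ := ht h₁₄ h₁ h₂₄ h₂ h₁₂
  have t₁₃ := ht h₁₄ h₁ h₃₄ h₃ h₁₃
  have t₂₃ := ht h₂₄ h₂ h₃₄ h₃ h₂₃
  rw [hU]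
  clear hU hI
  generalize Z₄ ∩ C.Z (dir a b k₁) (algebraMap K F k₁) = X at *
  generalize Z₄ ∩ C.Z (dir a b k₂) (algebraMap K F k₂) = Y at *
  generalize Z₄ ∩ C.Z (dir a b k₃) (algebraMap K F k₃) = W at *
  have f1 := card_union_add_card_inter X Y
  have f2 := card_union_add_card_inter (X ∪ Y) W
  rw [union_inter_distrib_right] at f2
  have f3 := card_union_add_card_inter (X ∩ W) (Y ∩ W)
  zify at *
  norm_num at e₃
  linarith

end CyclicCubic
end OrthogonalSpreads

/-! ### Alternating and symmetric matrices of size four -/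

namespace OrthogonalSpreads
open Matrix

variable {K V : Type*} [Field K] [AddCommGroup V] [Module K V]

/-- The alternating matrix with Pfaffian `x ⬝ᵥ y`. -/
def altMatrix (p : (Fin 3 → K) × (Fin 3 → K)) : Matrix (Fin 4) (Fin 4) K :=
  !![0, p.1 0, p.1 1, p.1 2; -p.1 0, 0, p.2 2, -p.2 1; -p.1 1, -p.2 2, 0, p.2 0;
    -p.1 2, p.2 1, -p.2 0, 0]

theorem altMatrix_sub (p p' : (Fin 3 → K) × (Fin 3 → K)) :
    altMatrix (p - p') = altMatrix p - altMatrix p' := by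
  ext i j
  fin_cases i <;> fin_cases j <;> simp [altMatrix] <;> ring

set_option maxRecDepth 4000 in
-- The adjugate of an alternating matrix of even size is alternating, so the correction `eᵀ adj(M)
-- e` vanishes and only the squared Pfaffian remains.
theorem det_altMatrix_add (p : (Fin 3 → K) × (Fin 3 → K)) (e : Fin 4 → K) :
    (altMatrix p + vecMulVec e e).det = (p.1 ⬝ᵥ p.2) ^ 2 := by
  simp [altMatrix, det_succ_row_zero, Fin.sum_univ_succ, vecMulVec_apply, dotProduct,
    Fin.succAbove]
  ring

theorem dotProduct_altMatrix_self (p : (Fin 3 → K) × (Fin 3 → K)) (x : Fin 4 → K) :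
    x ⬝ᵥ altMatrix p *ᵥ x = 0 := by
  simp [altMatrix, dotProduct, mulVec, Fin.sum_univ_succ]
  ring

/-- In characteristic two over a perfect field, a symmetric matrix is the sum of an alternating
one and a symmetric one of rank one. -/
theorem exists_altMatrix [CharP K 2] [Finite K] (N : Matrix (Fin 4) (Fin 4) K) (hN : Nᵀ = N) :
    ∃ p e, N = altMatrix p + vecMulVec e e := by
  have hs : ∀ i, ∃ x, N i i = x * x := fun i =>
    FiniteField.isSquare_of_char_two (ringChar.eq K 2) _
  choose e he using hs
  have h : ∀ i j, N j i = N i j := fun i j => congrFun (congrFun hN i) j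
  refine ⟨(![N 0 1 - e 0 * e 1, N 0 2 - e 0 * e 2, N 0 3 - e 0 * e 3],
    ![N 2 3 - e 2 * e 3, N 1 3 - e 1 * e 3, N 1 2 - e 1 * e 2]), e, ?_⟩
  have h2 : (2 : K) = 0 := CharTwo.two_eq_zero
  ext i j
  fin_cases i <;> fin_cases j <;> simp [altMatrix, vecMulVec, he, CharTwo.neg_eq, CharTwo.sub_eq_add]
  all_goals grind

end OrthogonalSpreads

/-! ### From point sets to maximal spreads -/

namespace OrthogonalSpreads
open Matrix

variable {K V : Type*} [Field K] [AddCommGroup V] [Module K V]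

theorem exists_hyperbolic_equiv {Q : QuadraticForm K V} (hQ : IsOPlusSpace 4 Q) :
    ∃ φ : ((Fin 4 → K) × (Fin 4 → K)) ≃ₗ[K] V, ∀ x, Q (φ x) = x.1 ⬝ᵥ x.2 := by
  obtain ⟨hfd, hfin, hnd, W, hW, hWs⟩ := hQ
  obtain ⟨U, hU⟩ := W.exists_isCompl
  have hUd : Module.finrank K U = 4 := by
    have := Submodule.finrank_add_eq_of_isCompl hU
    omega
  have hadd : ∀ x y, Q (x + y) = Q x + Q y + Q.polarBilin x y := fun x y => by
    simp [QuadraticMap.polar]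
  have hBW : ∀ x ∈ W, ∀ y ∈ W, Q.polarBilin x y = 0 := by
    intro x hx y hy
    have := hadd x y
    rw [hWs x hx, hWs y hy, hWs _ (W.add_mem hx hy)] at this
    simpa using this.symm
  let ψ₀ : W →ₗ[K] Module.Dual K U := Q.polarBilin.compl₁₂ W.subtype U.subtype
  have hψ₀ : Function.Injective ψ₀ := by
    rw [← LinearMap.ker_eq_bot, LinearMap.ker_eq_bot']
    intro w hw
    apply Subtype.ext
    apply hnd.1
    intro v
    obtain ⟨x, hx, u, hu, rfl⟩ := Submodule.mem_sup.1 (hU.sup_eq_top ▸ Submodule.mem_top (x := v))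
    rw [map_add, hBW _ w.2 _ hx, zero_add]
    exact LinearMap.congr_fun hw ⟨u, hu⟩
  let ψ : W ≃ₗ[K] Module.Dual K U := ψ₀.linearEquivOfInjective hψ₀ (by
    rw [Subspace.dual_finrank_eq, hUd, hW])
  have hψ : ∀ (l : Module.Dual K U) (u : U), Q.polarBilin (ψ.symm l) u = l u := by
    intro l u
    have : ψ₀ (ψ.symm l) = l := ψ.apply_symm_apply l
    exact LinearMap.congr_fun this u
  -- A complement `U` need not be singular. A bilinear form with `b u u = Q u` allows `u` to be
  -- corrected by an element of `W` without dividing by two.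
  obtain ⟨b, hb⟩ := LinearMap.BilinMap.toQuadraticMap_surjective (Q.comp U.subtype)
  have hb' : ∀ u : U, b u u = Q u := fun u => by
    rw [← LinearMap.BilinMap.toQuadraticMap_apply, hb]; rfl
  let β : Module.Basis (Fin 4) K U := Module.finBasisOfFinrankEq K U hUd
  let f : (Fin 4 → K) →ₗ[K] U := β.equivFun.symm
  let g : (Fin 4 → K) →ₗ[K] W := ψ.symm.toLinearMap ∘ₗ β.dualBasis.equivFun.symm.toLinearMap
  let φ₀ : (Fin 4 → K) × (Fin 4 → K) →ₗ[K] V :=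
    (U.subtype ∘ₗ f - W.subtype ∘ₗ ψ.symm ∘ₗ b ∘ₗ f).coprod (W.subtype ∘ₗ g)
  have hφ₀ : ∀ x, φ₀ x = (f x.1 : V) - ψ.symm (b (f x.1)) + g x.2 := fun x => by simp [φ₀]
  have hQφ : ∀ x, Q (φ₀ x) = x.1 ⬝ᵥ x.2 := by
    intro x
    have h1 : φ₀ x = ((g x.2 - ψ.symm (b (f x.1)) : W) : V) + f x.1 := by
      rw [hφ₀, Submodule.coe_sub]; abel
    rw [h1, hadd, hWs _ (Subtype.prop _), Submodule.coe_sub, map_sub, LinearMap.sub_apply, hψ, hb']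
    have h2 : Q.polarBilin (g x.2) (f x.1) = β.dualBasis.equivFun.symm x.2 (f x.1) := hψ _ _
    rw [h2]
    simp [f, Module.Basis.equivFun_symm_apply, dotProduct, LinearMap.sum_apply,
      Finsupp.single_apply]
  have hinj : Function.Injective φ₀ := by
    rw [← LinearMap.ker_eq_bot, LinearMap.ker_eq_bot']
    intro x hx
    rw [hφ₀] at hx
    have h1 : (f x.1 : V) ∈ W := by
      have : (f x.1 : V) = ((ψ.symm (b (f x.1)) - g x.2 : W) : V) := by
        rw [Submodule.coe_sub]
        rw [← sub_eq_zero, ← hx]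
        abel
      rw [this]; exact Subtype.prop _
    have h2 : f x.1 = 0 := by
      have := Submodule.disjoint_def.1 hU.disjoint _ h1 (f x.1).2
      exact Subtype.ext this
    have h3 : g x.2 = 0 := by
      rw [h2] at hx
      simpa using hx
    have h4 : x.1 = 0 := β.equivFun.symm.map_eq_zero_iff.1 h2
    have h5 : x.2 = 0 := β.dualBasis.equivFun.symm.map_eq_zero_iff.1
      (ψ.symm.map_eq_zero_iff.1 h3)
    exact Prod.ext h4 h5
  exact ⟨φ₀.linearEquivOfInjective hinj (by simp [hfin]), hQφ⟩

theorem exists_maximal_spread [CharP K 2] [Finite K] {Q : QuadraticForm K V}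
    (hQ : IsOPlusSpace 4 Q) (A : Finset ((Fin 3 → K) × (Fin 3 → K)))
    (h₁ : ∀ x ∈ A, ∀ y ∈ A, x ≠ y → (x - y).1 ⬝ᵥ (x - y).2 ≠ 0)
    (h₂ : ∀ x, ∃ y ∈ A, (x - y).1 ⬝ᵥ (x - y).2 = 0) :
    ∃ S : Set (Submodule K V), IsMaximalOrthogonalPartialSpread Q S ∧
      IsMaximalSymplecticPartialSpread Q.polarBilin S ∧ S.ncard = A.card + 1 := by
  obtain ⟨φ, hφ⟩ := exists_hyperbolic_equiv hQ
  have hfd := hQ.1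
  have hfin : Module.finrank K V = 8 := hQ.2.1
  have hB : ∀ x y, Q.polarBilin (φ x) (φ y) = x.1 ⬝ᵥ y.2 + y.1 ⬝ᵥ x.2 := by
    intro x y
    rw [QuadraticMap.polarBilin_apply_apply, QuadraticMap.polar, ← map_add, hφ, hφ, hφ]
    simp only [Prod.fst_add, Prod.snd_add, add_dotProduct, dotProduct_add]
    ring
  let W : Submodule K V := LinearMap.range (φ.toLinearMap ∘ₗ LinearMap.inr K _ _)
  let γ := fun p => φ.toLinearMap ∘ₗ LinearMap.id.prod (toLin' (altMatrix (K := K) p))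
  let G := fun p => LinearMap.range (γ p)
  have hW4 : Module.finrank K W = 4 := by
    rw [LinearMap.finrank_range_of_inj]
    · simp
    · exact φ.injective.comp LinearMap.inr_injective
  have hγ : ∀ p x, γ p x = φ (x, altMatrix p *ᵥ x) := fun p x => rfl
  have hG4 : ∀ p, Module.finrank K (G p) = 4 := by
    intro p
    rw [LinearMap.finrank_range_of_inj]
    · simp
    · intro x y h
      rw [hγ, hγ] at h
      exact congrArg Prod.fst (φ.injective h)
  have hWG : ∀ p, W ⊓ G p = ⊥ := by
    intro p
    rw [eq_bot_iff]
    rintro _ ⟨⟨y, rfl⟩, ⟨x, hx⟩⟩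
    rw [hγ] at hx
    have := φ.injective hx
    simp only [LinearMap.inr_apply, Prod.mk.injEq] at this
    obtain ⟨rfl, hy⟩ := this
    rw [mulVec_zero] at hy
    simp [← hy]
  have hker : ∀ (p : (Fin 3 → K) × (Fin 3 → K)) (x : Fin 4 → K), p.1 ⬝ᵥ p.2 ≠ 0 →
      altMatrix p *ᵥ x = 0 → x = 0 := by
    intro p x hp hx
    by_contra hx0
    have := exists_mulVec_eq_zero_iff.1 ⟨x, hx0, hx⟩
    have h := det_altMatrix_add p 0
    rw [vecMulVec_zero, add_zero, this] at h
    exact pow_ne_zero 2 hp h.symm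
  have hGG : ∀ p ∈ A, ∀ p' ∈ A, p ≠ p' → G p ⊓ G p' = ⊥ := by
    intro p hp p' hp' hne
    rw [eq_bot_iff]
    rintro _ ⟨⟨x, rfl⟩, ⟨y, hy⟩⟩
    rw [hγ, hγ] at hy
    have := φ.injective hy
    rw [Prod.mk.injEq] at this
    obtain ⟨rfl, hxy⟩ := this
    have hx := hker (p - p') y (h₁ p hp p' hp' hne)
      (by rw [altMatrix_sub, sub_mulVec, hxy, sub_self])
    subst hx
    simp
  have hne : ∀ X Y : Submodule K V, Module.finrank K X = 4 → X ⊓ Y = ⊥ → X ≠ Y := by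
    rintro X _ hX h rfl
    rw [inf_idem] at h
    rw [h, finrank_bot] at hX
    omega
  let S : Set (Submodule K V) := insert W (G '' A)
  have hS4 : ∀ X ∈ S, Module.finrank K X = 4 := by
    rintro X (rfl | ⟨p, -, rfl⟩)
    · exact hW4
    · exact hG4 p
  have hS : IsOrthogonalPartialSpread Q S := by
    refine ⟨⟨fun X hX => by rw [hS4 X hX, hfin], ?_⟩, ?_⟩
    · rintro X (rfl | ⟨p, hp, rfl⟩) Y (rfl | ⟨p', hp', rfl⟩) hXY
      · exact absurd rfl hXY
      · exact hWG p'
      · rw [inf_comm]; exact hWG p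
      · exact hGG p hp p' hp' fun h => hXY (h ▸ rfl)
    · rintro X (rfl | ⟨p, hp, rfl⟩) x hx
      · obtain ⟨y, rfl⟩ := hx
        simp [hφ]
      · obtain ⟨y, rfl⟩ := hx
        rw [hγ, hφ]
        exact dotProduct_altMatrix_self p y
  have hsym : ∀ T, IsOrthogonalPartialSpread Q T → IsSymplecticPartialSpread Q.polarBilin T := by
    intro T hT
    refine ⟨hT.1, fun X hX x hx y hy => ?_⟩
    rw [QuadraticMap.polarBilin_apply_apply, QuadraticMap.polar, hT.2 X hX x hx, hT.2 X hX y hy,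
      hT.2 X hX _ (X.add_mem hx hy)]
    ring
  -- A further member would be the graph of a symmetric `N`, equal to `altMatrix p` plus `e eᵀ`.
  -- Some `p'` in `A` has singular difference with `p`, so `N - altMatrix p'` is singular and the
  -- two graphs meet.
  have hmax : ∀ T, IsSymplecticPartialSpread Q.polarBilin T → S ⊆ T → T ⊆ S := by
    intro T hT hST Z hZT
    by_contra hZS
    have hdisj : ∀ X ∈ S, Z ⊓ X = ⊥ := fun X hX =>
      hT.1.2 Z hZT X (hST hX) fun h => hZS (h ▸ hX)
    have hZ4 : Module.finrank K Z = 4 := by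
      have := hT.1.1 Z hZT
      omega
    let π : Z →ₗ[K] (Fin 4 → K) := LinearMap.fst K _ _ ∘ₗ φ.symm.toLinearMap ∘ₗ Z.subtype
    have hπ : Function.Injective π := by
      rw [← LinearMap.ker_eq_bot, LinearMap.ker_eq_bot']
      intro z hz
      have : (z : V) ∈ Z ⊓ W := by
        refine ⟨z.2, (φ.symm z).2, ?_⟩
        have hz' : (φ.symm z).1 = 0 := hz
        rw [← φ.apply_symm_apply (z : V)]
        simp only [LinearMap.comp_apply, LinearMap.inr_apply, LinearEquiv.coe_coe, ← hz']
        simp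
      rw [hdisj W (Set.mem_insert _ _)] at this
      exact Subtype.ext ((Submodule.mem_bot K).1 this)
    let ε := π.linearEquivOfInjective hπ (by simp [hZ4])
    let ν : (Fin 4 → K) →ₗ[K] (Fin 4 → K) :=
      LinearMap.snd K _ _ ∘ₗ φ.symm.toLinearMap ∘ₗ Z.subtype ∘ₗ ε.symm.toLinearMap
    let N := LinearMap.toMatrix' ν
    have hN : ∀ x, φ (x, N *ᵥ x) ∈ Z := by
      intro x
      have h1 : N *ᵥ x = (φ.symm (ε.symm x)).2 := by
        rw [← toLin'_apply, toLin'_toMatrix']; rfl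
      have h2 : x = (φ.symm (ε.symm x)).1 := (ε.apply_symm_apply x).symm
      have h3 : (x, N *ᵥ x) = φ.symm (ε.symm x) := Prod.ext h2 h1
      rw [h3, φ.apply_symm_apply]
      exact Subtype.prop _
    have hNs : Nᵀ = N := by
      ext i j
      have := hT.2 Z hZT _ (hN (Pi.single i 1)) _ (hN (Pi.single j 1))
      rw [hB] at this
      simp only [single_one_dotProduct, mulVec_single_one, col_apply] at this
      exact (CharTwo.add_eq_zero.1 this).symm
    obtain ⟨p, e, hpe⟩ := exists_altMatrix N hNs
    obtain ⟨p', hp', hpp⟩ := h₂ p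
    have hdet := det_altMatrix_add (p - p') e
    rw [hpp, zero_pow two_ne_zero] at hdet
    obtain ⟨x, hx0, hx⟩ := exists_mulVec_eq_zero_iff.2 hdet
    have hxx : N *ᵥ x = altMatrix p' *ᵥ x := by
      rw [← sub_eq_zero, ← sub_mulVec, hpe, ← hx, altMatrix_sub]
      congr 1
      abel
    have hmem : φ (x, N *ᵥ x) ∈ Z ⊓ G p' := ⟨hN x, x, by rw [hγ, hxx]⟩
    rw [hdisj _ (Set.mem_insert_of_mem _ ⟨p', hp', rfl⟩), Submodule.mem_bot,
      LinearEquiv.map_eq_zero_iff] at hmem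
    exact hx0 (congrArg Prod.fst hmem)
  refine ⟨S, ⟨hS, fun T hT hST => hmax T (hsym T hT) hST⟩, ⟨hsym S hS, fun T hT hST => hmax T hT hST⟩,
    ?_⟩
  rw [Set.ncard_insert_of_notMem, Set.InjOn.ncard_image, Set.ncard_coe_finset]
  · intro p hp p' hp' h
    by_contra hpp
    exact hne _ _ (hG4 p) (hGG p hp p' hp' hpp) h
  · rintro ⟨p, -, h⟩
    exact hne _ _ hW4 (hWG p) h.symm

end OrthogonalSpreads

/-! ### Realization over finite fields -/

namespace OrthogonalSpreads
open Matrix Finset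

variable {K V : Type*} [Field K] [AddCommGroup V] [Module K V]

/-- The cyclic cubic structure of a cubic extension of finite fields of characteristic two. -/
noncomputable def finiteCyclicCubic (K F : Type*) [Field K] [Finite K] [Field F] [Finite F]
    [Algebra K F] [CharP F 2] (h : Module.finrank K F = 3) : CyclicCubic K F :=
  haveI := Fintype.ofFinite K
  haveI := Fintype.ofFinite F
  let σ := FiniteField.frobeniusAlgHom K F
  have hσ : ∀ x, σ x = x ^ Nat.card K := fun x => by
    rw [Nat.card_eq_fintype_card]; rfl
  have hT : ∀ x, algebraMap K F (Algebra.trace K F x) = x + σ x + σ (σ x) := fun x => by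
    rw [FiniteField.algebraMap_trace_eq_sum_pow, h]
    simp [Finset.sum_range_succ, hσ, ← pow_mul, sq]
  have hfix : ∀ x, σ x = x → ∃ k, algebraMap K F k = x := fun x hx =>
    ⟨Algebra.trace K F x, by
      rw [hT, hx, hx]
      linear_combination x * CyclicCubic.two_eq_zero (F := F)⟩
  { σ := σ
    T := Algebra.trace K F
    N := Algebra.norm K
    σ_three := fun x => by
      have := FiniteField.pow_card x
      rw [Module.card_eq_pow_finrank (K := K), h, ← Nat.card_eq_fintype_card] at this
      simp only [RingHom.coe_coe, hσ, ← pow_mul]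
      conv_rhs => rw [← this]
      ring_nf
    σ_algebraMap := fun k => σ.commutes k
    fixed := hfix
    exists_moved := by
      by_contra! hx
      have h1 : Function.Surjective (Algebra.linearMap K F) := fun x => hfix x (hx x)
      have := LinearMap.finrank_le_finrank_of_surjective h1
      rw [h, Module.finrank_self] at this
      omega
    algebraMap_T := hT
    algebraMap_N := fun x => by
      rw [FiniteField.algebraMap_norm_eq_prod_pow, h]
      simp [Finset.prod_range_succ, hσ, ← pow_mul, sq] }

/-- Dual coordinates turn the form `T(xy)` into the dot product. -/
theorem exists_dual_coordinates (K F : Type*) [Field K] [Finite K] [Field F] [Finite F]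
    [Algebra K F] [CharP F 2] (h : Module.finrank K F = 3) :
    ∃ ψ : (F × F) ≃+ (Fin 3 → K) × (Fin 3 → K),
      ∀ x, (ψ x).1 ⬝ᵥ (ψ x).2 = (finiteCyclicCubic K F h).form x := by
  have := Module.finite_of_finrank_pos (R := K) (M := F) (by omega)
  let b : Module.Basis (Fin 3) K F := Module.finBasisOfFinrankEq K F h
  let B := Algebra.traceForm K F
  have hB : B.Nondegenerate := traceForm_nondegenerate K F
  let b' := LinearMap.BilinForm.dualBasis B hB b
  refine ⟨(b.equivFun.prodCongr b'.equivFun).toAddEquiv, fun x => ?_⟩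
  have h1 : (finiteCyclicCubic K F h).form x = B x.1 x.2 := rfl
  rw [h1]
  conv_rhs => rw [← b.sum_equivFun x.1]
  simp only [map_sum, map_smul, LinearMap.sum_apply, LinearMap.smul_apply, smul_eq_mul, dotProduct]
  refine Finset.sum_congr rfl fun i _ => ?_
  congr 1
  have : b'.equivFun x.2 i = B x.2 (b i) :=
    LinearMap.BilinForm.dualBasis_repr_apply hB b x.2 i
  rw [Algebra.traceForm_apply, mul_comm, ← Algebra.traceForm_apply]
  exact this

theorem exists_maximal_spread_of_directions {F : Type*} [Field F] [Algebra K F] [CharP F 2]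
    [CharP K 2] [Fintype K] [Fintype F] [DecidableEq K] [DecidableEq F]
    (h : Module.finrank K F = 3) {Q : QuadraticForm K V} (hQ : IsOPlusSpace 4 Q) (I : Finset K)
    (c : K → F) (hI : I.Nonempty) (hc : ∀ k ∈ I, (finiteCyclicCubic K F h).T (c k) = 0)
    (hc0 : ∀ k ∈ I, c k ≠ 0)
    (hcc : ∀ k ∈ I, ∀ l ∈ I, k ≠ l → (finiteCyclicCubic K F h).T (c k * c l) ≠ 0)
    (hs : 3 * #I < Fintype.card K) :
    ∃ S : Set (Submodule K V), IsMaximalOrthogonalPartialSpread Q S ∧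
      IsMaximalSymplecticPartialSpread Q.polarBilin S ∧
      S.ncard + #((finiteCyclicCubic K F h).removed I c) = Fintype.card K ^ 3 + #I := by
  obtain ⟨A, hA, h₁, h₂⟩ := (finiteCyclicCubic K F h).exists_maximal_family
    (by rw [Module.card_eq_pow_finrank (K := K), h]) I c hI hc hc0 hcc hs
  obtain ⟨ψ, hψ⟩ := exists_dual_coordinates K F h
  obtain ⟨S, hS₁, hS₂, hS⟩ := exists_maximal_spread hQ (A.map ψ.toEquiv.toEmbedding)
    (by
      simp only [mem_map]
      rintro _ ⟨x, hx, rfl⟩ _ ⟨y, hy, rfl⟩ hxy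
      have h3 : ψ x - ψ y = ψ (x - y) := (map_sub ψ x y).symm
      change (ψ x - ψ y).1 ⬝ᵥ (ψ x - ψ y).2 ≠ 0
      rw [h3, hψ]
      exact h₁ x hx y hy fun h => hxy (h ▸ rfl))
    (by
      intro x
      obtain ⟨y, hy, hxy⟩ := h₂ (ψ.symm x)
      refine ⟨ψ y, mem_map_of_mem _ hy, ?_⟩
      rw [← hψ, map_sub, ψ.apply_symm_apply] at hxy
      exact hxy)
  exact ⟨S, hS₁, hS₂, by rw [hS, card_map, hA]⟩

end OrthogonalSpreads

/-! ### The two families of sizes -/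

theorem mainTheorem6 {K V : Type*} [Field K] [Finite K] [AddCommGroup V] [Module K V]
    (q : ℕ) (hq : Nat.card K = q) (hq_even : Even q) (hq_gt : 2 < q)
    (Q : QuadraticForm K V) (hQ : OrthogonalSpreads.IsOPlusSpace 4 Q) :
    (∀ s : ℕ, 1 ≤ s → (s : ℝ) ≤ (q : ℝ) / 5 →
      ∃ S : Set (Submodule K V),
        OrthogonalSpreads.IsMaximalOrthogonalPartialSpread Q S ∧
        OrthogonalSpreads.IsMaximalSymplecticPartialSpread Q.polarBilin S ∧
        (S.ncard : ℤ) = OrthogonalSpreads.spreadSize q s) ∧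
    (16 ≤ q →
      ∃ S : Set (Submodule K V),
        OrthogonalSpreads.IsMaximalOrthogonalPartialSpread Q S ∧
        OrthogonalSpreads.IsMaximalSymplecticPartialSpread Q.polarBilin S ∧
        (S.ncard : ℤ) = OrthogonalSpreads.spreadSize q 4 - 1) := by
  classical
  have := Fintype.ofFinite K
  rw [Nat.card_eq_fintype_card] at hq
  have hchar : ringChar K = 2 := by
    rw [FiniteField.even_card_iff_char_two, hq]
    exact Nat.even_iff.1 hq_even
  have : CharP K 2 := ringChar.of_eq hchar
  let F := FiniteField.Extension K 2 3
  have : CharP F 2 := charP_of_injective_algebraMap (algebraMap K F).injective 2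
  have := Fintype.ofFinite F
  have h : Module.finrank K F = 3 := FiniteField.finrank_extension K 2 3
  set C := OrthogonalSpreads.finiteCyclicCubic K F h
  obtain ⟨a, b, ha, hb, hab⟩ := C.exists_trace_zero_pair
  have hq3 : 3 ≤ Fintype.card K := by omega
  constructor
  · intro s hs1 hs5
    have hs5' : 5 * s ≤ q := by
      have : (5 * s : ℝ) ≤ q := by linarith
      exact_mod_cast this
    obtain ⟨I, -, hI⟩ := Finset.exists_subset_card_eq (s := (Finset.univ : Finset K)) (n := s)
      (by rw [Finset.card_univ]; omega)
    have hne : I.Nonempty := Finset.card_pos.1 (by omega)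
    obtain ⟨S, hS₁, hS₂, hS⟩ := OrthogonalSpreads.exists_maximal_spread_of_directions h hQ I
      (OrthogonalSpreads.CyclicCubic.dir a b) hne (fun k _ => C.T_dir ha hb k)
      (fun k _ => C.dir_ne_zero ha hb hab k) (fun k _ l _ => C.T_dir_mul_dir_ne ha hb hab)
      (by omega)
    refine ⟨S, hS₁, hS₂, ?_⟩
    have hR := C.card_removed ha hb hab hq3 hne
    rw [hI, hq] at hR hS
    zify at hS
    rw [OrthogonalSpreads.spreadSize]
    linear_combination hS - hR
  · intro hq16
    obtain ⟨I, -, hI⟩ := Finset.exists_subset_card_eq (s := (Finset.univ : Finset K)) (n := 3)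
      (by rwa [Finset.card_univ])
    obtain ⟨k₁, k₂, k₃, h₁₂, h₁₃, h₂₃, -⟩ := Finset.card_eq_three.1 hI
    obtain ⟨k₄, -, hk₄⟩ := Finset.exists_mem_notMem_of_card_lt_card (s := {k₁, k₂, k₃})
      (t := (Finset.univ : Finset K))
      (by rw [Finset.card_univ]; exact Finset.card_le_three.trans_lt (by omega))
    -- Choosing `j` different from all four poles puts the fourth point off the conic and keeps the
    -- four directions distinct.
    obtain ⟨j, -, hj⟩ := Finset.exists_mem_notMem_of_card_lt_card (s := {k₁, k₂, k₃, k₄})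
      (t := (Finset.univ : Finset K))
      (by rw [Finset.card_univ]; exact Finset.card_le_four.trans_lt (by omega))
    simp only [Finset.mem_insert, Finset.mem_singleton, not_or] at hk₄ hj
    obtain ⟨h₄₁, h₄₂, h₄₃⟩ := hk₄
    obtain ⟨hj₁, hj₂, hj₃, hj₄⟩ := hj
    have hc4 : ({k₁, k₂, k₃, k₄} : Finset K).card = 4 := by
      rw [Finset.card_insert_of_notMem, Finset.card_eq_three.2 ⟨k₂, k₃, k₄, h₂₃, Ne.symm h₄₂,
        Ne.symm h₄₃, rfl⟩]
      simp [h₁₂, h₁₃, Ne.symm h₄₁]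
    have hdir : ∀ k : K, ∃ l : K, OrthogonalSpreads.CyclicCubic.dir' a b j k₄ k =
        OrthogonalSpreads.CyclicCubic.dir a b l := by
      intro k
      unfold OrthogonalSpreads.CyclicCubic.dir'
      split_ifs
      exacts [⟨j, rfl⟩, ⟨k, rfl⟩]
    obtain ⟨S, hS₁, hS₂, hS⟩ := OrthogonalSpreads.exists_maximal_spread_of_directions h hQ
      {k₁, k₂, k₃, k₄} (OrthogonalSpreads.CyclicCubic.dir' a b j k₄) (by simp)
      (fun k _ => by obtain ⟨l, hl⟩ := hdir k; rw [hl]; exact C.T_dir ha hb l)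
      (fun k _ => by obtain ⟨l, hl⟩ := hdir k; rw [hl]; exact C.dir_ne_zero ha hb hab l)
      (by
        intro k hk l hl hkl
        have hkj : k ≠ j := by
          rintro rfl
          simp [hj₁, hj₂, hj₃, hj₄] at hk
        have hlj : l ≠ j := by
          rintro rfl
          simp [hj₁, hj₂, hj₃, hj₄] at hl
        unfold OrthogonalSpreads.CyclicCubic.dir'
        split_ifs with e₁ e₂ e₂
        · exact absurd (e₁.trans e₂.symm) hkl
        · exact C.T_dir_mul_dir_ne ha hb hab hlj.symm
        · exact C.T_dir_mul_dir_ne ha hb hab hkj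
        · exact C.T_dir_mul_dir_ne ha hb hab hkl)
      (by rw [hc4]; omega)
    refine ⟨S, hS₁, hS₂, ?_⟩
    have hR := C.card_removed_four ha hb hab hq3 h₁₂ h₁₃ h₂₃ (Ne.symm h₄₁) (Ne.symm h₄₂)
      (Ne.symm h₄₃) (Ne.symm hj₁) (Ne.symm hj₂) (Ne.symm hj₃) (Ne.symm hj₄)
    rw [hc4, hq] at hS
    rw [hq] at hR
    zify at hS
    rw [OrthogonalSpreads.spreadSize]
    norm_num [Nat.choose]
    linear_combination hS - hR
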